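/- **Setting.** A tabular episodic MDP has a finite state set $\mathcal S$ with $|\mathcal S|=S$, a finite action set $\mathcal A$ with $|\mathcal A|=A$, horizon $H$, transition kernels $\mathcal P_h(\cdot\mid s,a)$, deterministic rewards $r_h:\mathcal S\times\mathcal A\to[0,1]$ ($h\in[H]$) and a fixed initial state $s_1$. A policy is $\pi=\{\pi_h:\mathcal S\to\mathcal A\}_{h\in[H]}$. For a risk parameter $\beta\neq0$ let $$V_h^\pi(s)=\tfrac1\beta\log\mathbb E\Big[e^{\beta\sum_{i=h}^H r_i(s_i,\pi_i(s_i))}\,\Big|\,s_h=s\Big],$$ let $Q_h^\pi(s,a)$ be the same quantity conditioned on $s_h=s$, $a_h=a$ (with $\pi$ followed from step $h+1$ on), and let $V_h^*=\sup_\pi V_h^\pi$, $Q_h^*=\sup_\pi Q_h^\pi$. For a trajectory $\tau=\{(s_j,a_j)\}_{j\in[H]}$ put $R(\tau_{h-1})=\sum_{j<h}r_j(s_j,a_j)$, and define the cascaded gap $$\Delta_h(s,a;\tau_{h-1})=\psi_\beta\,e^{\beta R(\tau_{h-1})}\big[e^{\beta V_h^*(s)}-e^{\beta Q_h^*(s,a)}\big],$$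 where $\psi_\beta=1/\beta$ if $\beta>0$ and $\psi_\beta=e^{-\beta H}/\beta$ if $\beta<0$. Let $\Delta_{\min}$ be the minimum of the nonzero values of $\Delta_h(s,a;\tau_{h-1})$ over all $h,s,a$ and all trajectories $\tau$; it is assumed that some gap is nonzero, so that $\Delta_{\min}>0$. **Algorithm RSVI2** (inputs $K\ge1$, $\delta\in(0,1]$, $\beta\ne0$; bonus constant $c>0$). Before episode $k$, let $N_h(s,a)$ be the number of episodes $i<k$ with $(s_h^i,a_h^i)=(s,a)$. Put $V_{H+1}\equiv0$, and for $h=H,\dots,1$ put $Q_h(s,a)=H-h+1$ if $N_h(s,a)=0$, and otherwise $Q_h(s,a)=\frac1\beta\log G_h(s,a)$ with $$w_h(s,a)=\frac1{N_h(s,a)}\sum_{i<k}\mathbb 1\{(s_h^i,a_h^i)=(s,a)\}\,e^{\beta[r_h(s,a)+V_{h+1}(s_{h+1}^i)]},$$ $$b_h(s,a)=c\,\big|e^{\beta(H-h+1)}-1\big|\sqrt{\frac{S\log(2SAHK/\delta)}{N_h(s,a)}},$$ $$G_h(s,a)=\begin{cases}\min\{e^{\beta(H-h+1)},\,w_h(s,a)+b_h(s,a)\},&\beta>0,\\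 \max\{e^{\beta(H-h+1)},\,w_h(s,a)-b_h(s,a)\},&\beta<0,\end{cases}$$ and $V_h(s)=\max_{a}Q_h(s,a)$. In episode $k$ it follows the policy $\pi^k_h(s)\in\arg\max_a Q_h(s,a)$ (ties broken by any rule that depends on the earlier episodes). Its regret is $\mathcal R(K)=\sum_{k=1}^K(V_1^*-V_1^{\pi^k})(s_1)$. **Theorem.** There is a universal constant $c_0>0$ such that for every $c\ge c_0$ there is a constant $C>0$, depending only on $c$, for which the following holds for every MDP as above, every $\beta\ne0$, $K\ge1$ and $\delta\in(0,1]$. If RSVI2 is run with bonus constant $c$ and confidence level $\delta$, then with probability at least $1-\delta$ $$\mathcal R(K)\le C\,\frac{(e^{|\beta|H}-1)^2H^3S^2A}{|\beta|^2\Delta_{\min}}\,\log(HSAK/\delta)^2 .$$ Moreover, if $\delta\ge\frac1{HK}$ (in particular for $\delta=\frac1{HK}$), then $$\mathbb E[\mathcal R(K)]\le C\,\frac{(e^{|\beta|H}-1)^2H^3S^2A}{|\beta|^2\Delta_{\min}}\,\log(HSAK)^2 .$$ -/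

import Mathlib

noncomputable section

namespace RiskSensitiveRL

/-! ### Finite probability -/

/-- Expectation of a real function under a probability mass function on a finite type. -/
def expect {Ω : Type*} [Fintype Ω] (p : PMF Ω) (f : Ω → ℝ) : ℝ :=
  ∑ ω, (p ω).toReal * f ω

/-- Probability of an event under a probability mass function on a finite type. -/
def prob {Ω : Type*} [Fintype Ω] (p : PMF Ω) (E : Set Ω) : ℝ :=
  expect p (E.indicator fun _ => 1)

/-! ### Episodic Markov decision processes

Steps are indexed from `0`: the index `h : Fin H` is the `(h + 1)`-st step of an episode, and an
episode visits `H + 1` states, the last of which comes after the last action. Hence the number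
`H - h + 1` of steps that remain at the (one-based) step `h` reads `H - h` below. -/

/-- A tabular episodic MDP with horizon `H`: transition kernels, deterministic rewards in `[0, 1]`
and a fixed initial state. -/
structure MDP (S A : Type*) (H : ℕ) where
  P : Fin H → S → A → PMF S
  r : Fin H → S → A → ℝ
  r_mem : ∀ h s a, r h s a ∈ Set.Icc (0 : ℝ) 1
  s₁ : S

/-- A policy: one map from states to actions for every step. -/
abbrev Policy (S A : Type*) (H : ℕ) : Type _ := Fin H → S → A

/-- A completed episode: the `H + 1` visited states and the `H` actions taken. -/
abbrev Episode (S A : Type*) (H : ℕ) : Type _ := (Fin (H + 1) → S) × (Fin H → A)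

section Value

variable {S A : Type*} {H : ℕ} (M : MDP S A H)

/-- Law of the states visited from step `h` on, when the state at step `h` is `s` and the actions
follow `π`. A path is a function on all `H + 1` indices; its entries at indices before `h` carry
no information. -/
def pathLaw (π : Policy S A H) (h : Fin (H + 1)) : S → PMF (Fin (H + 1) → S) :=
  Fin.reverseInduction (motive := fun _ => S → PMF (Fin (H + 1) → S))
    (fun s => PMF.pure fun _ => s)
    (fun i next s =>
      (M.P i s (π i s)).bind fun s' => (next s').map fun x => Function.update x i.castSucc s)
    h

/-- The reward collected by `π` along the path `x` from step `h` on. -/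
def rewardFrom (π : Policy S A H) (h : Fin (H + 1)) (x : Fin (H + 1) → S) : ℝ :=
  ∑ i ∈ Finset.univ.filter (fun i : Fin H => h ≤ i.castSucc),
    M.r i (x i.castSucc) (π i (x i.castSucc))

variable [Fintype S]

/-- State-value function of `π` for the entropic risk measure with parameter `β`. -/
def V (β : ℝ) (π : Policy S A H) (h : Fin (H + 1)) (s : S) : ℝ :=
  1 / β * Real.log (expect (pathLaw M π h s) fun x => Real.exp (β * rewardFrom M π h x))

/-- Action-value function of `π`: action `a` is taken at step `h`, and `π` is followed after. -/
def Q (β : ℝ) (π : Policy S A H) (h : Fin H) (s : S) (a : A) : ℝ :=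
  1 / β * Real.log (expect ((M.P h s a).bind (pathLaw M π h.succ)) fun x =>
    Real.exp (β * (M.r h s a + rewardFrom M π h.succ x)))

/-- Optimal state-value function. -/
def VStar (β : ℝ) (h : Fin (H + 1)) (s : S) : ℝ := ⨆ π : Policy S A H, V M β π h s

/-- Optimal action-value function. -/
def QStar (β : ℝ) (h : Fin H) (s : S) (a : A) : ℝ := ⨆ π : Policy S A H, Q M β π h s a

/-! ### Cascaded gaps -/

/-- Normalization factor of the cascaded gaps. -/
def psi (H : ℕ) (β : ℝ) : ℝ := if 0 < β then 1 / β else Real.exp (-β * H) / β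

/-- Cascaded gap of `(s, a)` at step `h`; only the part of the trajectory `τ` strictly before
step `h` enters. -/
def gap (β : ℝ) (h : Fin H) (s : S) (a : A) (τ : Fin H → S × A) : ℝ :=
  psi H β * Real.exp (β * ∑ j ∈ Finset.univ.filter (· < h), M.r j (τ j).1 (τ j).2) *
    (Real.exp (β * VStar M β h.castSucc s) - Real.exp (β * QStar M β h s a))

/-- Minimal nonzero cascaded gap: the least element of a finite set of positive numbers (if every
gap vanishes, the set is empty and the value is `0`). -/
def minGap (β : ℝ) : ℝ :=
  sInf {x : ℝ | x ≠ 0 ∧ ∃ h s a τ, x = gap M β h s a τ}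

end Value

/-! ### The algorithm RSVI2

`D : Fin k → Episode S A H` is the record of the first `k` episodes; the definitions below give the
tables that RSVI2 holds when it starts to act in the next episode. `c` is the constant in the bonus,
`K` the total number of episodes and `δ` the confidence level handed to the algorithm. -/

section Algorithm

variable {S A : Type*} [Fintype S] [Fintype A] [DecidableEq S] [DecidableEq A] {H : ℕ}
  (M : MDP S A H) (β δ c : ℝ) (K : ℕ) {k : ℕ} (D : Fin k → Episode S A H)

/-- Past episodes that took action `a` in state `s` at step `h`. -/
def visits (h : Fin H) (s : S) (a : A) : Finset (Fin k) :=
  Finset.univ.filter fun i => (D i).1 h.castSucc = s ∧ (D i).2 h = a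

/-- Visit count `N_h(s, a)`. -/
def count (h : Fin H) (s : S) (a : A) : ℕ := (visits D h s a).card

/-- Sample average `w_h(s, a)`, where `v` is the current estimate of the next step's values. -/
def wHat (v : S → ℝ) (h : Fin H) (s : S) (a : A) : ℝ :=
  1 / (count D h s a : ℝ) *
    ∑ i ∈ visits D h s a, Real.exp (β * (M.r h s a + v ((D i).1 h.succ)))

/-- Doubly decaying bonus `b_h(s, a)`. -/
def bonus (h : Fin H) (s : S) (a : A) : ℝ :=
  c * |Real.exp (β * ((H : ℝ) - (h : ℕ))) - 1| *
    √((Fintype.card S : ℝ) *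
        Real.log (2 * Fintype.card S * Fintype.card A * H * K / δ) / (count D h s a : ℝ))

/-- Optimistic estimate of the exponential action value. -/
def gHat (v : S → ℝ) (h : Fin H) (s : S) (a : A) : ℝ :=
  if 0 < β then
    min (Real.exp (β * ((H : ℝ) - (h : ℕ)))) (wHat M β D v h s a + bonus β δ c K D h s a)
  else
    max (Real.exp (β * ((H : ℝ) - (h : ℕ)))) (wHat M β D v h s a - bonus β δ c K D h s a)

/-- The action-value table at step `h` computed from next-step values `v`; a pair never visited
keeps its initial value. -/
def qFrom (v : S → ℝ) (h : Fin H) (s : S) (a : A) : ℝ :=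
  if count D h s a = 0 then (H : ℝ) - (h : ℕ) else 1 / β * Real.log (gHat M β δ c K D v h s a)

/-- The value table of RSVI2, computed backwards from `0` after the last step. -/
def vHat (h : Fin (H + 1)) : S → ℝ :=
  Fin.reverseInduction (motive := fun _ => S → ℝ)
    (fun _ => 0) (fun i next s => ⨆ a, qFrom M β δ c K D next i s a) h

/-- The action-value table of RSVI2. -/
def qHat (h : Fin H) (s : S) (a : A) : ℝ :=
  qFrom M β δ c K D (vHat M β δ c K D h.succ) h s a

/-- A learner: the policy executed in an episode as a function of the earlier episodes. -/
abbrev Learner (S A : Type*) (H : ℕ) : Type _ :=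
  (k : ℕ) → (Fin k → Episode S A H) → Policy S A H

/-- `alg` is RSVI2, with ties in the `argmax` broken by an arbitrary rule: in each episode it
acts greedily for the action-value table of that episode. -/
def IsRSVI2 (alg : Learner S A H) : Prop :=
  ∀ k, k < K → ∀ (D : Fin k → Episode S A H) (h : Fin H) (s : S) (a : A),
    qHat M β δ c K D h s a ≤ qHat M β δ c K D h s (alg k D h s)

end Algorithm

/-! ### Interaction and regret -/

section Interaction

variable {S A : Type*} {H : ℕ} (M : MDP S A H)

/-- Law of one episode, started at the initial state, under `π`. -/
def episodeLaw (π : Policy S A H) : PMF (Episode S A H) :=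
  (pathLaw M π 0 M.s₁).map fun x => (x, fun h => π h (x h.castSucc))

/-- Joint law of the first `k` episodes produced by a learner. -/
def runLaw (alg : Learner S A H) : (k : ℕ) → PMF (Fin k → Episode S A H)
  | 0 => PMF.pure fun i => i.elim0
  | k + 1 => (runLaw alg k).bind fun D =>
      (episodeLaw M (alg k D)).map fun e => Fin.snoc (α := fun _ => Episode S A H) D e

/-- Regret over the `K` episodes recorded in `D`. -/
def regret [Fintype S] (β : ℝ) (alg : Learner S A H) {K : ℕ} (D : Fin K → Episode S A H) : ℝ :=
  ∑ k : Fin K, (VStar M β 0 M.s₁ -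
    V M β (alg k fun i : Fin k => D (Fin.castLE k.isLt.le i)) 0 M.s₁)

end Interaction

end RiskSensitiveRL

end

open RiskSensitiveRL

noncomputable section
namespace RiskSensitiveRL

/-! ### Calculus of finite expectations -/

section Expect

variable {Ω Ω' : Type*} [Fintype Ω] [Fintype Ω']

/-! Everything is measured on the scale of the utility `util β v = exp (β v) / β`, which increases
in `v` for either sign of `β`. On this scale the entropic Bellman backup is linear: it multiplies by
`exp (β r)` and averages. The factor in a cascaded gap (`weight`) picks up exactly this `exp (β r)`
at each step, so weighted differences of utilities pass from one step to the next with no loss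
(`weight_mul_util_backup_sub`), and they never exceed B = `gapBound` = (e^{|β|H} - 1)/|β|.

On the concentration event the value tables are optimistic, and the weighted surplus of one backup
after n visits is at most min(B, 2B√(b/n)), with b of order c² S log(2SAHK/δ). By AM-GM this is at
most a charge min(B, bB²/(εn)) plus a slack ε (`mul_surplusRate_le`). Take ε = Δ_min/(2H), so that
the slack of a whole episode is at most Δ_min/2. If the chosen action has zero gap, nothing is lost
at that step. Otherwise the weighted loss X is at least Δ_min, so X ≤ charges + X/2. Induction
bounds the regret of an episode by twice its expected charges (`weight_mul_util_VStar_sub_le`).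

The expected charge of an episode is the conditional mean increment of `visitPotential`, and that
potential is bounded for every record by a harmonic sum. This gives the bound in expectation. With
high probability, the supermartingale `expect_exp_sumEarlier_sub_visitPotential_le_one` costs only a
factor 2 and an additive term of order HB log(2/δ).

Concentration is required for all events at the next state, hence holds uniformly over all next-step
value functions, so the dependence of the tables on the data is harmless. The 2^S events are paid
for by the factor S in the bonus. Failure is controlled by a sum of exponential supermartingales,
one for each step, pair, event and possible visit count (`failureBound`). -/

theorem sum_toReal_eq_one (p : PMF Ω) : ∑ ω, (p ω).toReal = 1 := by
  rw [← ENNReal.toReal_sum fun ω _ => p.apply_ne_top ω, ← tsum_fintype (L := .unconditional _),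
    p.tsum_coe, ENNReal.toReal_one]

theorem expect_const (p : PMF Ω) (c : ℝ) : expect p (fun _ => c) = c := by
  simp [expect, ← Finset.sum_mul, sum_toReal_eq_one]

theorem expect_mono (p : PMF Ω) {f g : Ω → ℝ} (h : ∀ ω, f ω ≤ g ω) : expect p f ≤ expect p g :=
  Finset.sum_le_sum fun ω _ => mul_le_mul_of_nonneg_left (h ω) ENNReal.toReal_nonneg

theorem expect_le_of_le (p : PMF Ω) {f : Ω → ℝ} {c : ℝ} (h : ∀ ω, f ω ≤ c) : expect p f ≤ c :=
  (expect_mono p h).trans_eq (expect_const p c)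

theorem le_expect_of_le (p : PMF Ω) {f : Ω → ℝ} {c : ℝ} (h : ∀ ω, c ≤ f ω) : c ≤ expect p f :=
  (expect_const p c).symm.trans_le (expect_mono p h)

theorem expect_add (p : PMF Ω) (f g : Ω → ℝ) :
    expect p (fun ω => f ω + g ω) = expect p f + expect p g := by
  simp [expect, mul_add, Finset.sum_add_distrib]

theorem expect_sub (p : PMF Ω) (f g : Ω → ℝ) :
    expect p (fun ω => f ω - g ω) = expect p f - expect p g := by
  simp [expect, mul_sub, Finset.sum_sub_distrib]

theorem expect_const_mul (p : PMF Ω) (c : ℝ) (f : Ω → ℝ) :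
    expect p (fun ω => c * f ω) = c * expect p f := by
  simp only [expect, Finset.mul_sum]
  exact Finset.sum_congr rfl fun _ _ => by ring

theorem expect_div_const (p : PMF Ω) (f : Ω → ℝ) (c : ℝ) :
    expect p (fun ω => f ω / c) = expect p f / c := by
  simp only [expect, Finset.sum_div]
  exact Finset.sum_congr rfl fun _ _ => by ring

theorem expect_sum (p : PMF Ω) {ι : Type*} (s : Finset ι) (f : ι → Ω → ℝ) :
    expect p (fun ω => ∑ i ∈ s, f i ω) = ∑ i ∈ s, expect p (f i) := by
  simp only [expect, Finset.mul_sum]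
  exact Finset.sum_comm

theorem expect_pure (x : Ω) (f : Ω → ℝ) : expect (PMF.pure x) f = f x := by
  classical
  simp [expect, PMF.pure_apply, apply_ite ENNReal.toReal]

theorem expect_bind (p : PMF Ω) (q : Ω → PMF Ω') (f : Ω' → ℝ) :
    expect (p.bind q) f = expect p fun ω => expect (q ω) f := by
  have h (y : Ω') : (p.bind q y).toReal = ∑ ω, (p ω).toReal * (q ω y).toReal := by
    rw [PMF.bind_apply, tsum_fintype, ENNReal.toReal_sum fun ω _ =>
      ENNReal.mul_ne_top (p.apply_ne_top ω) ((q ω).apply_ne_top y)]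
    simp
  simp only [expect, h, Finset.sum_mul, Finset.mul_sum]
  rw [Finset.sum_comm]
  exact Finset.sum_congr rfl fun _ _ => Finset.sum_congr rfl fun _ _ => by ring

theorem expect_map (p : PMF Ω) (g : Ω → Ω') (f : Ω' → ℝ) :
    expect (p.map g) f = expect p fun ω => f (g ω) := by
  rw [← PMF.bind_pure_comp, expect_bind]
  simp [expect_pure]

theorem expect_pos (p : PMF Ω) {f : Ω → ℝ} (h : ∀ ω, 0 < f ω) : 0 < expect p f := by
  obtain ⟨x, hx⟩ := p.support_nonempty
  refine Finset.sum_pos' (fun ω _ => mul_nonneg ENNReal.toReal_nonneg (h ω).le)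
    ⟨x, Finset.mem_univ _, mul_pos ?_ (h x)⟩
  exact ENNReal.toReal_pos ((PMF.mem_support_iff p x).1 hx) (p.apply_ne_top x)

end Expect

/-! ### Recursions for the path law -/

section Path

variable {S A : Type*} {H : ℕ} (M : MDP S A H) (π : Policy S A H)

theorem pathLaw_last (s : S) : pathLaw M π (Fin.last H) s = PMF.pure fun _ => s := by
  simp [pathLaw]

theorem pathLaw_castSucc (i : Fin H) (s : S) :
    pathLaw M π i.castSucc s = (M.P i s (π i s)).bind fun s' =>
      (pathLaw M π i.succ s').map fun x => Function.update x i.castSucc s := by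
  simp [pathLaw]

theorem filter_le_castSucc (i : Fin H) :
    Finset.univ.filter (fun j : Fin H => i.castSucc ≤ j.castSucc) =
      insert i (Finset.univ.filter fun j : Fin H => i.succ ≤ j.castSucc) := by
  ext j
  simp only [Finset.mem_filter, Finset.mem_univ, true_and, Finset.mem_insert, Fin.le_def,
    Fin.ext_iff, Fin.val_castSucc, Fin.val_succ]
  omega

theorem sum_from_update (i : Fin H) (s : S) (x : Fin (H + 1) → S) (g : Fin H → S → ℝ) :
    ∑ j ∈ Finset.univ.filter (fun j : Fin H => i.castSucc ≤ j.castSucc),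
        g j (Function.update x i.castSucc s j.castSucc) =
      g i s + ∑ j ∈ Finset.univ.filter (fun j : Fin H => i.succ ≤ j.castSucc),
        g j (x j.castSucc) := by
  rw [filter_le_castSucc, Finset.sum_insert (by simp [Fin.le_def])]
  simp only [Function.update_self]
  congr 1
  refine Finset.sum_congr rfl fun j hj => ?_
  rw [Function.update_of_ne]
  intro h
  have h' := (Finset.mem_filter.1 hj).2
  rw [h] at h'
  simp [Fin.le_def] at h'

theorem sum_from_last (x : Fin (H + 1) → S) (g : Fin H → S → ℝ) :
    ∑ j ∈ Finset.univ.filter (fun j : Fin H => Fin.last H ≤ j.castSucc), g j (x j.castSucc) = 0 := by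
  rw [Finset.filter_false_of_mem, Finset.sum_empty]
  intro j _
  simp [Fin.le_def]

theorem rewardFrom_update (i : Fin H) (s : S) (x : Fin (H + 1) → S) :
    rewardFrom M π i.castSucc (Function.update x i.castSucc s) =
      M.r i s (π i s) + rewardFrom M π i.succ x :=
  sum_from_update i s x fun j s => M.r j s (π j s)

theorem rewardFrom_last (x : Fin (H + 1) → S) : rewardFrom M π (Fin.last H) x = 0 :=
  sum_from_last x fun j s => M.r j s (π j s)

variable [Fintype S]

theorem expect_pathLaw_castSucc (i : Fin H) (s : S) (f : (Fin (H + 1) → S) → ℝ) :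
    expect (pathLaw M π i.castSucc s) f = expect (M.P i s (π i s)) fun s' =>
      expect (pathLaw M π i.succ s') fun x => f (Function.update x i.castSucc s) := by
  rw [pathLaw_castSucc, expect_bind]
  simp only [expect_map]

/-- A path drawn from step `h` on records its own starting state at index `h`; only earlier indices
hold placeholders. -/
theorem expect_pathLaw_start (h : Fin (H + 1)) (s : S) (f : S → (Fin (H + 1) → S) → ℝ) :
    expect (pathLaw M π h s) (fun x => f (x h) x) = expect (pathLaw M π h s) (f s) := by
  induction h using Fin.lastCases with
  | last => simp [pathLaw_last, expect_pure]
  | cast i => simp [expect_pathLaw_castSucc]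

/-- Expected total of the costs `g` collected from step `h` on. -/
def costToGo (g : Fin H → S → ℝ) (h : Fin (H + 1)) (s : S) : ℝ :=
  expect (pathLaw M π h s) fun x =>
    ∑ j ∈ Finset.univ.filter (fun j : Fin H => h ≤ j.castSucc), g j (x j.castSucc)

theorem costToGo_last (g : Fin H → S → ℝ) (s : S) : costToGo M π g (Fin.last H) s = 0 := by
  simp only [costToGo, sum_from_last, expect_const]

theorem costToGo_castSucc (g : Fin H → S → ℝ) (i : Fin H) (s : S) :
    costToGo M π g i.castSucc s =
      g i s + expect (M.P i s (π i s)) (costToGo M π g i.succ) := by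
  unfold costToGo
  simp only [expect_pathLaw_castSucc, sum_from_update, expect_add, expect_const]

theorem costToGo_nonneg {g : Fin H → S → ℝ} (hg : ∀ h s, 0 ≤ g h s) (h : Fin (H + 1)) (s : S) :
    0 ≤ costToGo M π g h s :=
  le_expect_of_le _ fun _ => Finset.sum_nonneg fun _ _ => hg _ _

theorem costToGo_zero (g : Fin H → S → ℝ) (s : S) :
    costToGo M π g 0 s = expect (pathLaw M π 0 s) fun x => ∑ j, g j (x j.castSucc) := by
  simp [costToGo]

/-- If a function of a transition at step `h` has conditional mean at most `b`, so it has along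
the path. -/
theorem expect_transition_le {h : Fin H} {g : S → S → ℝ} {b : ℝ}
    (hg : ∀ s, expect (M.P h s (π h s)) (g s) ≤ b) (j : Fin (H + 1)) (hj : j ≤ h.castSucc) (s : S) :
    expect (pathLaw M π j s) (fun x => g (x h.castSucc) (x h.succ)) ≤ b := by
  induction j using Fin.reverseInduction generalizing s with
  | last =>
    have := h.isLt
    simp only [Fin.le_def, Fin.val_last, Fin.val_castSucc] at hj
    omega
  | cast i ih =>
    rw [expect_pathLaw_castSucc]
    rcases eq_or_ne i h with rfl | hne
    · refine le_of_eq_of_le ?_ (hg s)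
      congr 1
      funext s'
      have hn : i.succ ≠ i.castSucc := by simp [Fin.ext_iff]
      simp only [Function.update_self, Function.update_of_ne hn]
      rw [expect_pathLaw_start M π i.succ s' fun y _ => g s y, expect_const]
    · have h1 : i.succ ≤ h.castSucc := by
        simp only [Fin.le_def, Fin.val_castSucc, Fin.val_succ] at hj ⊢
        have := Fin.val_ne_of_ne hne
        omega
      have h2 : h.castSucc ≠ i.castSucc := by simpa [Fin.ext_iff] using fun h => hne (Fin.ext h.symm)
      have h3 : h.succ ≠ i.castSucc := by
        simp only [Fin.le_def, Fin.val_castSucc, Fin.val_succ, ne_eq, Fin.ext_iff] at h1 ⊢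
        omega
      refine expect_le_of_le _ fun s' => ?_
      simp only [Function.update_of_ne h2, Function.update_of_ne h3]
      exact ih h1 s'

end Path

/-! ### Recursions for the law of a run -/

section Run

variable {S A : Type*} {H : ℕ} (M : MDP S A H) (alg : Learner S A H)

/-- The first `k` episodes of a record. -/
def earlier {E : Type*} {k K : ℕ} (h : k ≤ K) (D : Fin K → E) : Fin k → E :=
  fun i => D (Fin.castLE h i)

theorem earlier_snoc {E : Type*} {k K : ℕ} (h : k ≤ K) (D : Fin K → E) (e : E) :
    earlier (h.trans K.le_succ) (Fin.snoc (α := fun _ => E) D e) = earlier h D := by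
  funext i
  exact Fin.snoc_castSucc (α := fun _ => E) e D (Fin.castLE h i)

/-- Sum over the episodes of a record of a function of the preceding episodes. -/
def sumEarlier (φ : (k : ℕ) → (Fin k → Episode S A H) → ℝ) {K : ℕ}
    (D : Fin K → Episode S A H) : ℝ :=
  ∑ k : Fin K, φ k (earlier k.isLt.le D)

theorem sumEarlier_snoc (φ : (k : ℕ) → (Fin k → Episode S A H) → ℝ) {K : ℕ}
    (D : Fin K → Episode S A H) (e : Episode S A H) :
    sumEarlier φ (Fin.snoc (α := fun _ => Episode S A H) D e) = sumEarlier φ D + φ K D := by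
  rw [sumEarlier, Fin.sum_univ_castSucc]
  congr 1
  · refine Finset.sum_congr rfl fun k _ => ?_
    exact congrArg (φ k) (earlier_snoc k.isLt.le D e)
  · exact congrArg (φ K) (earlier_snoc le_rfl D e)

variable [Fintype S] [Fintype A]

theorem expect_episodeLaw (π : Policy S A H) (f : Episode S A H → ℝ) :
    expect (episodeLaw M π) f =
      expect (pathLaw M π 0 M.s₁) fun x => f (x, fun h => π h (x h.castSucc)) :=
  expect_map _ _ _

theorem expect_runLaw_succ (k : ℕ) (f : (Fin (k + 1) → Episode S A H) → ℝ) :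
    expect (runLaw M alg (k + 1)) f = expect (runLaw M alg k) fun D =>
      expect (episodeLaw M (alg k D)) fun e =>
        f (Fin.snoc (α := fun _ => Episode S A H) D e) := by
  rw [runLaw, expect_bind]
  simp only [expect_map]

theorem expect_runLaw_zero (f : (Fin 0 → Episode S A H) → ℝ) :
    expect (runLaw M alg 0) f = f fun i => i.elim0 :=
  expect_pure _ _

theorem expect_runLaw_earlier {k K : ℕ} (h : k ≤ K) (f : (Fin k → Episode S A H) → ℝ) :
    expect (runLaw M alg K) (fun D => f (earlier h D)) = expect (runLaw M alg k) f := by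
  induction K, h using Nat.le_induction with
  | base => rfl
  | succ K h ih =>
    rw [expect_runLaw_succ]
    simp only [earlier_snoc h, expect_const]
    exact ih

theorem expect_sumEarlier (φ : (k : ℕ) → (Fin k → Episode S A H) → ℝ) (K : ℕ) :
    expect (runLaw M alg K) (sumEarlier φ) = ∑ k : Fin K, expect (runLaw M alg k) (φ k) := by
  unfold sumEarlier
  rw [expect_sum]
  exact Finset.sum_congr rfl fun k _ => expect_runLaw_earlier M alg k.isLt.le (φ k)

end Run

/-! ### Exponential utility -/

/-- The exponential utility `exp (β v) / β`, increasing in `v` for both signs of `β`. -/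
def util (β v : ℝ) : ℝ := Real.exp (β * v) / β

/-- The derivative of `util β` is `exp (β v)`, which is monotone, so its minimum on an interval is
at an endpoint. The sign of `β` decides which one. -/
theorem min_exp_mul_sub_le_util_sub {β : ℝ} (hβ : β ≠ 0) {x y : ℝ} (hyx : y ≤ x) :
    min (Real.exp (β * x)) (Real.exp (β * y)) * (x - y) ≤ util β x - util β y := by
  have key (x y : ℝ) :
      Real.exp (β * y) * (β * (x - y)) ≤ Real.exp (β * x) - Real.exp (β * y) := by
    have h := mul_le_mul_of_nonneg_left (Real.add_one_le_exp (β * (x - y))) (Real.exp_pos (β * y)).le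
    rw [← Real.exp_add, show β * y + β * (x - y) = β * x by ring] at h
    linarith
  rw [util, util, ← sub_div]
  rcases hβ.lt_or_gt with h | h
  · refine (mul_le_mul_of_nonneg_right (min_le_left _ _) (sub_nonneg.2 hyx)).trans ?_
    rw [le_div_iff_of_neg h]
    linarith [key y x]
  · refine (mul_le_mul_of_nonneg_right (min_le_right _ _) (sub_nonneg.2 hyx)).trans ?_
    rw [le_div_iff₀ h]
    linarith [key x y]

theorem util_strictMono {β : ℝ} (hβ : β ≠ 0) : StrictMono (util β) := by
  intro x y h
  have h1 := min_exp_mul_sub_le_util_sub hβ h.le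
  have := mul_pos (lt_min (Real.exp_pos (β * y)) (Real.exp_pos (β * x))) (sub_pos.2 h)
  linarith

theorem exp_mul_util (β x y : ℝ) : Real.exp (β * x) * util β y = util β (x + y) := by
  rw [util, util, mul_add, Real.exp_add, mul_div_assoc]

/-! ### Bellman recursions and optimal values of the entropic criterion. -/

section Bellman

variable {S A : Type*} {H : ℕ} (M : MDP S A H) [Fintype S] {β : ℝ}

/-- The entropic Bellman backup of next-step values `v`. -/
def backup (β : ℝ) (h : Fin H) (s : S) (a : A) (v : S → ℝ) : ℝ :=
  1 / β * Real.log (expect (M.P h s a) fun s' => Real.exp (β * (M.r h s a + v s')))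

theorem util_backup (hβ : β ≠ 0) (h : Fin H) (s : S) (a : A) (v : S → ℝ) :
    util β (backup M β h s a v) = expect (M.P h s a) fun s' => util β (M.r h s a + v s') := by
  rw [util, backup, ← mul_assoc, mul_one_div_cancel hβ, one_mul,
    Real.exp_log (expect_pos _ fun _ => Real.exp_pos _), ← expect_div_const]
  rfl

/-- Linearity of the backup on the utility scale; the factor `exp (β r)` is what `weight`
accumulates. -/
theorem util_backup' (hβ : β ≠ 0) (h : Fin H) (s : S) (a : A) (v : S → ℝ) :
    util β (backup M β h s a v) =
      Real.exp (β * M.r h s a) * expect (M.P h s a) fun s' => util β (v s') := by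
  simp only [util_backup M hβ, ← exp_mul_util, expect_const_mul]

theorem backup_mono (hβ : β ≠ 0) (h : Fin H) (s : S) (a : A) {v w : S → ℝ} (hvw : ∀ s, v s ≤ w s) :
    backup M β h s a v ≤ backup M β h s a w := by
  rw [← (util_strictMono hβ).le_iff_le, util_backup M hβ, util_backup M hβ]
  exact expect_mono _ fun s' => (util_strictMono hβ).monotone (by linarith [hvw s'])

theorem backup_nonneg (hβ : β ≠ 0) (h : Fin H) (s : S) (a : A) {v : S → ℝ} (hv : ∀ s, 0 ≤ v s) :
    0 ≤ backup M β h s a v := by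
  rw [← (util_strictMono hβ).le_iff_le, util_backup M hβ]
  exact le_expect_of_le _ fun s' =>
    (util_strictMono hβ).monotone (by linarith [hv s', (M.r_mem h s a).1])

theorem backup_le (hβ : β ≠ 0) (h : Fin H) (s : S) (a : A) {v : S → ℝ} {b : ℝ}
    (hv : ∀ s, v s ≤ b) : backup M β h s a v ≤ b + 1 := by
  rw [← (util_strictMono hβ).le_iff_le, util_backup M hβ]
  exact expect_le_of_le _ fun s' =>
    (util_strictMono hβ).monotone (by linarith [hv s', (M.r_mem h s a).2])

theorem exp_V (hβ : β ≠ 0) (π : Policy S A H) (h : Fin (H + 1)) (s : S) :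
    Real.exp (β * V M β π h s) =
      expect (pathLaw M π h s) fun x => Real.exp (β * rewardFrom M π h x) := by
  rw [V, ← mul_assoc, mul_one_div_cancel hβ, one_mul,
    Real.exp_log (expect_pos _ fun _ => Real.exp_pos _)]

theorem V_last (π : Policy S A H) (s : S) : V M β π (Fin.last H) s = 0 := by
  simp [V, rewardFrom_last, expect_const]

theorem expect_exp_add_rewardFrom (hβ : β ≠ 0) (π : Policy S A H) (h : Fin (H + 1)) (s : S) (r : ℝ) :
    expect (pathLaw M π h s) (fun x => Real.exp (β * (r + rewardFrom M π h x))) =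
      Real.exp (β * (r + V M β π h s)) := by
  simp only [mul_add, Real.exp_add, expect_const_mul, exp_V M hβ]

theorem V_castSucc (hβ : β ≠ 0) (π : Policy S A H) (h : Fin H) (s : S) :
    V M β π h.castSucc s = backup M β h s (π h s) (V M β π h.succ) := by
  rw [V, backup, expect_pathLaw_castSucc]
  simp only [rewardFrom_update, expect_exp_add_rewardFrom M hβ]

theorem Q_eq_backup (hβ : β ≠ 0) (π : Policy S A H) (h : Fin H) (s : S) (a : A) :
    Q M β π h s a = backup M β h s a (V M β π h.succ) := by
  rw [Q, backup, expect_bind]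
  simp only [expect_exp_add_rewardFrom M hβ]

theorem V_nonneg (hβ : β ≠ 0) (π : Policy S A H) (h : Fin (H + 1)) (s : S) :
    0 ≤ V M β π h s := by
  induction h using Fin.reverseInduction generalizing s with
  | last => rw [V_last]
  | cast i ih =>
    rw [V_castSucc M hβ]
    exact backup_nonneg M hβ _ _ _ ih

theorem V_le (hβ : β ≠ 0) (π : Policy S A H) (h : Fin (H + 1)) (s : S) :
    V M β π h s ≤ (H : ℝ) - (h : ℕ) := by
  induction h using Fin.reverseInduction generalizing s with
  | last => simp [V_last]
  | cast i ih =>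
    rw [V_castSucc M hβ]
    refine (backup_le M hβ _ _ _ ih).trans_eq ?_
    simp only [Fin.val_succ, Fin.val_castSucc, Nat.cast_add, Nat.cast_one]
    ring

/-- The values computed by backward induction with the optimal Bellman backup. -/
def bellmanValue (β : ℝ) (h : Fin (H + 1)) : S → ℝ :=
  Fin.reverseInduction (motive := fun _ => S → ℝ)
    (fun _ => 0) (fun i next s => ⨆ a, backup M β i s a next) h

theorem bellmanValue_last (s : S) : bellmanValue M β (Fin.last H) s = 0 := by
  simp [bellmanValue]

theorem bellmanValue_castSucc (h : Fin H) (s : S) :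
    bellmanValue M β h.castSucc s = ⨆ a, backup M β h s a (bellmanValue M β h.succ) := by
  simp [bellmanValue]

variable [Fintype A]

theorem V_le_bellmanValue (hβ : β ≠ 0) (π : Policy S A H) (h : Fin (H + 1)) (s : S) :
    V M β π h s ≤ bellmanValue M β h s := by
  induction h using Fin.reverseInduction generalizing s with
  | last => rw [V_last, bellmanValue_last]
  | cast i ih =>
    rw [V_castSucc M hβ, bellmanValue_castSucc]
    exact (backup_mono M hβ _ _ _ ih).trans (le_ciSup
      (f := fun a => backup M β i s a (bellmanValue M β i.succ)) (Set.finite_range _).bddAbove (π i s))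

variable [Nonempty A]

/-- A policy greedy for the backward induction is optimal at all steps and states at once, so a
single policy attains every supremum in `VStar`. -/
theorem exists_V_eq_bellmanValue (hβ : β ≠ 0) :
    ∃ π : Policy S A H, ∀ h s, V M β π h s = bellmanValue M β h s := by
  choose π hπ using fun (h : Fin H) (s : S) =>
    exists_eq_ciSup_of_finite (f := fun a => backup M β h s a (bellmanValue M β h.succ))
  refine ⟨π, fun h => ?_⟩
  induction h using Fin.reverseInduction with
  | last => intro s; rw [V_last, bellmanValue_last]
  | cast i ih =>
    intro s
    rw [V_castSucc M hβ, bellmanValue_castSucc, ← hπ, funext ih]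

theorem VStar_eq_bellmanValue (hβ : β ≠ 0) (h : Fin (H + 1)) (s : S) :
    VStar M β h s = bellmanValue M β h s := by
  obtain ⟨π, hπ⟩ := exists_V_eq_bellmanValue M hβ
  refine le_antisymm (ciSup_le fun π => V_le_bellmanValue M hβ π h s) ?_
  rw [← hπ]
  exact le_ciSup (f := fun π => V M β π h s)
    ⟨_, Set.forall_mem_range.2 fun π => V_le_bellmanValue M hβ π h s⟩ π

theorem exists_V_eq_VStar (hβ : β ≠ 0) :
    ∃ π : Policy S A H, ∀ h s, V M β π h s = VStar M β h s := by
  simp only [VStar_eq_bellmanValue M hβ]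
  exact exists_V_eq_bellmanValue M hβ

theorem V_le_VStar (hβ : β ≠ 0) (π : Policy S A H) (h : Fin (H + 1)) (s : S) :
    V M β π h s ≤ VStar M β h s := by
  rw [VStar_eq_bellmanValue M hβ]
  exact V_le_bellmanValue M hβ π h s

theorem QStar_eq_backup (hβ : β ≠ 0) (h : Fin H) (s : S) (a : A) :
    QStar M β h s a = backup M β h s a (VStar M β h.succ) := by
  have hle (π : Policy S A H) : Q M β π h s a ≤ backup M β h s a (VStar M β h.succ) := by
    rw [Q_eq_backup M hβ]
    exact backup_mono M hβ _ _ _ fun s' => V_le_VStar M hβ π _ s'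
  obtain ⟨π, hπ⟩ := exists_V_eq_VStar M hβ
  refine le_antisymm (ciSup_le hle) ?_
  refine le_of_eq_of_le ?_ (le_ciSup (f := fun π => Q M β π h s a)
    ⟨_, Set.forall_mem_range.2 hle⟩ π)
  rw [Q_eq_backup M hβ, funext (hπ h.succ)]

theorem VStar_last (hβ : β ≠ 0) (s : S) : VStar M β (Fin.last H) s = 0 := by
  rw [VStar_eq_bellmanValue M hβ, bellmanValue_last]

theorem VStar_castSucc (hβ : β ≠ 0) (h : Fin H) (s : S) :
    VStar M β h.castSucc s = ⨆ a, QStar M β h s a := by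
  simp only [QStar_eq_backup M hβ, VStar_eq_bellmanValue M hβ, bellmanValue_castSucc,
    funext (VStar_eq_bellmanValue M hβ h.succ)]

theorem QStar_le_VStar (hβ : β ≠ 0) (h : Fin H) (s : S) (a : A) :
    QStar M β h s a ≤ VStar M β h.castSucc s := by
  rw [VStar_castSucc M hβ]
  exact le_ciSup (f := fun a => QStar M β h s a) (Set.finite_range _).bddAbove a

theorem exists_QStar_eq_VStar (hβ : β ≠ 0) (h : Fin H) (s : S) :
    ∃ a, QStar M β h s a = VStar M β h.castSucc s := by
  rw [VStar_castSucc M hβ]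
  exact exists_eq_ciSup_of_finite

theorem VStar_nonneg (hβ : β ≠ 0) (h : Fin (H + 1)) (s : S) : 0 ≤ VStar M β h s := by
  obtain ⟨π, hπ⟩ := exists_V_eq_VStar M hβ
  exact (V_nonneg M hβ π h s).trans_eq (hπ h s)

theorem VStar_le (hβ : β ≠ 0) (h : Fin (H + 1)) (s : S) :
    VStar M β h s ≤ (H : ℝ) - (h : ℕ) := by
  obtain ⟨π, hπ⟩ := exists_V_eq_VStar M hβ
  exact (hπ h s).symm.trans_le (V_le M hβ π h s)

theorem QStar_nonneg (hβ : β ≠ 0) (h : Fin H) (s : S) (a : A) : 0 ≤ QStar M β h s a := by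
  rw [QStar_eq_backup M hβ]
  exact backup_nonneg M hβ _ _ _ (VStar_nonneg M hβ _)

end Bellman

/-! ### Averages and bonuses on the utility scale. -/

theorem abs_exp_sub_one_div_abs {β : ℝ} (hβ : β ≠ 0) {n : ℝ} (hn : 0 ≤ n) :
    |Real.exp (β * n) - 1| / |β| = util β n - util β 0 := by
  rw [← abs_div, util, util, ← sub_div, mul_zero, Real.exp_zero]
  refine abs_of_nonneg ?_
  have := (util_strictMono hβ).monotone hn
  simp only [util, mul_zero, Real.exp_zero] at this
  rw [sub_div]
  linarith

theorem wHat_div {S A : Type*} [DecidableEq S] [DecidableEq A] {H : ℕ} (M : MDP S A H) {k : ℕ}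
    (D : Fin k → Episode S A H) (β : ℝ) (v : S → ℝ) (h : Fin H) (s : S) (a : A) :
    wHat M β D v h s a / β = 1 / (count D h s a : ℝ) *
      ∑ i ∈ visits D h s a, util β (M.r h s a + v ((D i).1 h.succ)) := by
  simp only [wHat, util, mul_div_assoc, Finset.sum_div]

/-! ### The tables of RSVI2 -/

section Tables

variable {S A : Type*} [Fintype S] [DecidableEq S] [DecidableEq A] {H : ℕ}
  (M : MDP S A H) {k : ℕ} (D : Fin k → Episode S A H)

/-- Deviation of the visits' total of `f` at the next state from its conditional mean. -/
def deviation (h : Fin H) (s : S) (a : A) (f : S → ℝ) : ℝ :=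
  ∑ i ∈ visits D h s a, (f ((D i).1 h.succ) - expect (M.P h s a) f)

theorem deviation_add_const_mul (h : Fin H) (s : S) (a : A) (x y : ℝ) (f : S → ℝ) :
    deviation M D h s a (fun t => x + y * f t) = y * deviation M D h s a f := by
  simp only [deviation, expect_add, expect_const, expect_const_mul, Finset.mul_sum]
  exact Finset.sum_congr rfl fun _ _ => by ring

theorem deviation_eq_sum (h : Fin H) (s : S) (a : A) (f : S → ℝ) :
    deviation M D h s a f = ∑ t, f t * deviation M D h s a (fun u => if u = t then 1 else 0) := by
  have h1 : f = fun u => ∑ t, f t * (if u = t then 1 else 0) := by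
    funext u
    simp
  conv_lhs => rw [h1]
  simp only [deviation, expect_sum, expect_const_mul]
  simp only [← Finset.sum_sub_distrib, ← mul_sub, Finset.mul_sum]
  exact Finset.sum_comm

/-- The deviations of all events at the next state are at most `ρ` times the visit count. -/
def IsConcentrated (ρ : Fin H → S → A → ℝ) : Prop :=
  ∀ h s a (U : Finset S),
    deviation M D h s a (fun t => if t ∈ U then 1 else 0) ≤ count D h s a * ρ h s a

variable {M D} {ρ : Fin H → S → A → ℝ}

/-- The deviation is linear in `f`, so over the cube of functions with values in [0, 1] it is
largest at a vertex: the indicator of the states whose coefficient is nonnegative. -/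
theorem IsConcentrated.deviation_le (hD : IsConcentrated M D ρ) (h : Fin H) (s : S) (a : A)
    {f : S → ℝ} (h0 : ∀ t, 0 ≤ f t) (h1 : ∀ t, f t ≤ 1) :
    deviation M D h s a f ≤ count D h s a * ρ h s a := by
  set x : S → ℝ := fun t => deviation M D h s a (fun u => if u = t then 1 else 0) with hx
  refine le_trans ?_ (hD h s a (Finset.univ.filter fun t => 0 ≤ x t))
  rw [deviation_eq_sum, deviation_eq_sum M D h s a fun t => if t ∈ _ then 1 else 0]
  refine Finset.sum_le_sum fun t _ => ?_
  change f t * x t ≤ _ * x t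
  simp only [Finset.mem_filter, Finset.mem_univ, true_and]
  split_ifs with ht
  · exact mul_le_mul_of_nonneg_right (h1 t) ht
  · rw [zero_mul]
    exact mul_nonpos_of_nonneg_of_nonpos (h0 t) (not_le.1 ht).le

theorem IsConcentrated.abs_deviation_le (hD : IsConcentrated M D ρ) (h : Fin H) (s : S) (a : A)
    {f : S → ℝ} {x y : ℝ} (hxy : x ≤ y) (h0 : ∀ t, x ≤ f t) (h1 : ∀ t, f t ≤ y) :
    |deviation M D h s a f| ≤ (y - x) * (count D h s a * ρ h s a) := by
  set g : S → ℝ := fun t => (f t - x) / (y - x)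
  have hf : f = fun t => x + (y - x) * g t := by
    funext t
    -- When the range is a point, the division in `g` returns 0 and `f` is constant.
    rcases hxy.eq_or_lt with rfl | hlt
    · linarith [h0 t, h1 t]
    · have : y - x ≠ 0 := (sub_pos.2 hlt).ne'
      simp only [g]
      field_simp
      ring
  have hg0 (t : S) : 0 ≤ g t := div_nonneg (sub_nonneg.2 (h0 t)) (sub_nonneg.2 hxy)
  have hg1 (t : S) : g t ≤ 1 := div_le_one_of_le₀ (by linarith [h1 t]) (sub_nonneg.2 hxy)
  have e1 := hD.deviation_le h s a hg0 hg1
  -- Constants have no deviation, so `1 - g` yields the lower bound.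
  have e2 := hD.deviation_le h s a (f := fun t => 1 + (-1) * g t) (fun t => by linarith [hg1 t])
    (fun t => by linarith [hg0 t])
  rw [deviation_add_const_mul] at e2
  rw [hf, deviation_add_const_mul, abs_mul, abs_of_nonneg (sub_nonneg.2 hxy)]
  exact mul_le_mul_of_nonneg_left (abs_le.2 ⟨by linarith, e1⟩) (sub_nonneg.2 hxy)

variable [Fintype A] (M D) {β δ c : ℝ} {K : ℕ}

/-- The bonus without its range factor. -/
def relBonus (A : Type*) [Fintype A] [DecidableEq A] (δ c : ℝ) (K : ℕ)
    (D : Fin k → Episode S A H) (h : Fin H) (s : S) (a : A) : ℝ :=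
  c * √((Fintype.card S : ℝ) *
        Real.log (2 * Fintype.card S * Fintype.card A * H * K / δ) / (count D h s a : ℝ))

theorem one_le_sub_val (h : Fin H) : (1 : ℝ) ≤ (H : ℝ) - (h : ℕ) := by
  have : ((h : ℕ) : ℝ) + 1 ≤ H := by exact_mod_cast h.isLt
  linarith

theorem sub_val_succ (h : Fin H) :
    (H : ℝ) - (h.succ : ℕ) = (H : ℝ) - (h : ℕ) - 1 := by
  simp only [Fin.val_succ, Nat.cast_add, Nat.cast_one]
  ring

theorem bonus_div_abs (hβ : β ≠ 0) (h : Fin H) (s : S) (a : A) :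
    bonus β δ c K D h s a / |β| =
      (util β ((H : ℝ) - (h : ℕ)) - util β 0) * relBonus A δ c K D h s a := by
  rw [← abs_exp_sub_one_div_abs hβ (zero_le_one.trans (one_le_sub_val h)), bonus, relBonus]
  ring

/-- Division by a negative `β` turns the `max` and the subtracted bonus into a `min` and an added
one, so both signs share one formula from here on. -/
theorem gHat_div (hβ : β ≠ 0) (v : S → ℝ) (h : Fin H) (s : S) (a : A) :
    gHat M β δ c K D v h s a / β = min (util β ((H : ℝ) - (h : ℕ)))
      (wHat M β D v h s a / β + bonus β δ c K D h s a / |β|) := by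
  rcases hβ.lt_or_gt with hneg | hpos
  · rw [gHat, if_neg hneg.le.not_gt, abs_of_neg hneg, util, div_neg, ← sub_eq_add_neg, ← sub_div]
    have hanti : Antitone fun x : ℝ => x / β := fun x y hxy => div_le_div_of_nonpos_of_le hneg.le hxy
    exact hanti.map_max
  · rw [gHat, if_pos hpos, abs_of_pos hpos, util, ← add_div]
    have hmono : Monotone fun x : ℝ => x / β := fun x y hxy => div_le_div_of_nonneg_right hxy hpos.le
    exact hmono.map_min

theorem util_qFrom (hβ : β ≠ 0) (hc : 0 ≤ c) (v : S → ℝ) (h : Fin H) (s : S) (a : A)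
    (hN : count D h s a ≠ 0) :
    util β (qFrom M β δ c K D v h s a) = min (util β ((H : ℝ) - (h : ℕ)))
      (wHat M β D v h s a / β + bonus β δ c K D h s a / |β|) := by
  -- Needed for `exp` to undo `log`: for positive `β` a visited pair has a positive average, for
  -- negative `β` the clipping level is positive.
  have hpos : 0 < gHat M β δ c K D v h s a := by
    rw [gHat]
    split_ifs with hb
    · refine lt_min (Real.exp_pos _) (add_pos_of_pos_of_nonneg ?_ ?_)
      · refine mul_pos (one_div_pos.2 (by exact_mod_cast Nat.pos_of_ne_zero hN))
          (Finset.sum_pos (fun _ _ => Real.exp_pos _) ?_)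
        exact Finset.card_ne_zero.1 hN
      · exact mul_nonneg (mul_nonneg hc (abs_nonneg _)) (Real.sqrt_nonneg _)
    · exact lt_max_of_lt_left (Real.exp_pos _)
  rw [qFrom, if_neg hN, ← gHat_div M D hβ, util, ← mul_assoc, mul_one_div_cancel hβ, one_mul,
    Real.exp_log hpos]

theorem qFrom_le (hβ : β ≠ 0) (hc : 0 ≤ c) (v : S → ℝ) (h : Fin H) (s : S) (a : A) :
    qFrom M β δ c K D v h s a ≤ (H : ℝ) - (h : ℕ) := by
  by_cases hN : count D h s a = 0
  · rw [qFrom, if_pos hN]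
  · rw [← (util_strictMono hβ).le_iff_le, util_qFrom M D hβ hc v h s a hN]
    exact min_le_left _ _

theorem qFrom_nonneg (hβ : β ≠ 0) (hc : 0 ≤ c) {v : S → ℝ} (hv : ∀ t, 0 ≤ v t) (h : Fin H) (s : S)
    (a : A) : 0 ≤ qFrom M β δ c K D v h s a := by
  have hH := one_le_sub_val h
  by_cases hN : count D h s a = 0
  · rw [qFrom, if_pos hN]
    linarith
  · have hmono := (util_strictMono hβ).monotone
    rw [← (util_strictMono hβ).le_iff_le, util_qFrom M D hβ hc v h s a hN]
    refine le_min (hmono (by linarith)) ?_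
    have hb : 0 ≤ bonus β δ c K D h s a / |β| :=
      div_nonneg (mul_nonneg (mul_nonneg hc (abs_nonneg _)) (Real.sqrt_nonneg _)) (abs_nonneg _)
    refine le_add_of_le_of_nonneg ?_ hb
    have hN' : (0 : ℝ) < count D h s a := by exact_mod_cast Nat.pos_of_ne_zero hN
    rw [wHat_div, one_div, ← div_eq_inv_mul, le_div_iff₀ hN', mul_comm, ← nsmul_eq_mul]
    exact Finset.card_nsmul_le_sum _ _ _ fun i _ =>
      hmono (by linarith [(M.r_mem h s a).1, hv ((D i).1 h.succ)])

theorem vHat_last (s : S) : vHat M β δ c K D (Fin.last H) s = 0 := by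
  simp [vHat]

theorem vHat_castSucc (h : Fin H) (s : S) :
    vHat M β δ c K D h.castSucc s = ⨆ a, qHat M β δ c K D h s a := by
  simp [vHat, qHat]

theorem qHat_le_vHat (h : Fin H) (s : S) (a : A) :
    qHat M β δ c K D h s a ≤ vHat M β δ c K D h.castSucc s := by
  rw [vHat_castSucc]
  exact le_ciSup (f := fun a => qHat M β δ c K D h s a) (Set.finite_range _).bddAbove a

/-- Bound on the surplus of an optimistic backup relative to the range, after `n` visits. -/
def surplusRate (b : ℝ) (n : ℕ) : ℝ := if n = 0 then 1 else min 1 (2 * √(b / n))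

variable {D}

/-- The empirical mean is within one bonus of the true mean, so after adding the bonus it overshoots
by at most two. Since `v` is arbitrary within its range, it may depend on the record. An unvisited
pair sits at the top of the range, which accounts for the rate 1. -/
theorem util_qFrom_bounds (hβ : β ≠ 0) (hc : 0 ≤ c)
    (hD : IsConcentrated M D (relBonus A δ c K D)) {v : S → ℝ} (h : Fin H) (s : S) (a : A)
    (hv0 : ∀ t, 0 ≤ v t) (hv1 : ∀ t, v t ≤ (H : ℝ) - (h : ℕ) - 1) :
    util β (backup M β h s a v) ≤ util β (qFrom M β δ c K D v h s a) ∧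
    util β (qFrom M β δ c K D v h s a) ≤ util β (backup M β h s a v) +
      (util β ((H : ℝ) - (h : ℕ)) - util β 0) * surplusRate (c ^ 2 * ((Fintype.card S : ℝ) *
        Real.log (2 * Fintype.card S * Fintype.card A * H * K / δ))) (count D h s a) := by
  have hmono := (util_strictMono hβ).monotone
  have hH := one_le_sub_val h
  set T := util β ((H : ℝ) - (h : ℕ)) with hT
  have hr := M.r_mem h s a
  have hf0 (t : S) : util β 0 ≤ util β (M.r h s a + v t) := hmono (by linarith [hv0 t, hr.1])
  have hf1 (t : S) : util β (M.r h s a + v t) ≤ T := hmono (by linarith [hv1 t, hr.2])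
  have hT0 : util β 0 ≤ T := hmono (by linarith)
  rw [util_backup M hβ]
  set f : S → ℝ := fun t => util β (M.r h s a + v t) with hf
  set p := expect (M.P h s a) f with hp
  have hp0 : util β 0 ≤ p := le_expect_of_le _ hf0
  have hp1 : p ≤ T := expect_le_of_le _ hf1
  by_cases hN : count D h s a = 0
  · rw [qFrom, if_pos hN, surplusRate, if_pos hN]
    exact ⟨hp1, by linarith⟩
  · rw [util_qFrom M D hβ hc v h s a hN, surplusRate, if_neg hN, wHat_div, bonus_div_abs D hβ]
    have hN' : (0 : ℝ) < count D h s a := by exact_mod_cast Nat.pos_of_ne_zero hN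
    have hdev := hD.abs_deviation_le h s a hT0 hf0 hf1
    have hw : 1 / (count D h s a : ℝ) * ∑ i ∈ visits D h s a, f ((D i).1 h.succ) =
        p + deviation M D h s a f / count D h s a := by
      rw [deviation, Finset.sum_sub_distrib, Finset.sum_const, nsmul_eq_mul]
      change _ = p + (_ - (count D h s a : ℝ) * p) / _
      field_simp
      ring
    change _ ≤ min T (1 / (count D h s a : ℝ) * ∑ i ∈ visits D h s a, f ((D i).1 h.succ) + _) ∧
      min T (1 / (count D h s a : ℝ) * ∑ i ∈ visits D h s a, f ((D i).1 h.succ) + _) ≤ _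
    rw [hw]
    have hd : |deviation M D h s a f / count D h s a| ≤ (T - util β 0) * relBonus A δ c K D h s a := by
      rw [abs_div, abs_of_pos hN', div_le_iff₀ hN']
      linarith
    have hρ : relBonus A δ c K D h s a = √(c ^ 2 * ((Fintype.card S : ℝ) *
        Real.log (2 * Fintype.card S * Fintype.card A * H * K / δ)) / (count D h s a : ℝ)) := by
      rw [relBonus, mul_div_assoc (c ^ 2), Real.sqrt_mul (sq_nonneg c), Real.sqrt_sq hc]
    rw [← hρ]
    obtain ⟨d1, d2⟩ := abs_le.1 hd
    refine ⟨le_min hp1 (by linarith), ?_⟩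
    rcases min_cases 1 (2 * relBonus A δ c K D h s a) with ⟨e, -⟩ | ⟨e, -⟩
    · rw [e]
      exact (min_le_left _ _).trans (by linarith)
    · rw [e]
      exact (min_le_right _ _).trans (by linarith)

variable [Nonempty A]

theorem vHat_mem (D : Fin k → Episode S A H) (hβ : β ≠ 0) (hc : 0 ≤ c) (h : Fin (H + 1)) (s : S) :
    0 ≤ vHat M β δ c K D h s ∧ vHat M β δ c K D h s ≤ (H : ℝ) - (h : ℕ) := by
  induction h using Fin.reverseInduction generalizing s with
  | last => simp [vHat_last]
  | cast i ih =>
    rw [vHat_castSucc]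
    obtain ⟨a, ha⟩ := exists_eq_ciSup_of_finite (f := fun a => qHat M β δ c K D i s a)
    rw [← ha]
    exact ⟨qFrom_nonneg M D hβ hc (fun t => (ih t).1) _ _ _, qFrom_le M D hβ hc _ _ _ _⟩

theorem util_qHat_bounds (hβ : β ≠ 0) (hc : 0 ≤ c)
    (hD : IsConcentrated M D (relBonus A δ c K D)) (h : Fin H) (s : S) (a : A) :
    util β (backup M β h s a (vHat M β δ c K D h.succ)) ≤ util β (qHat M β δ c K D h s a) ∧
    util β (qHat M β δ c K D h s a) ≤ util β (backup M β h s a (vHat M β δ c K D h.succ)) +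
      (util β ((H : ℝ) - (h : ℕ)) - util β 0) * surplusRate (c ^ 2 * ((Fintype.card S : ℝ) *
        Real.log (2 * Fintype.card S * Fintype.card A * H * K / δ))) (count D h s a) :=
  util_qFrom_bounds M hβ hc hD h s a (fun t => (vHat_mem M D hβ hc h.succ t).1)
    fun t => sub_val_succ h ▸ (vHat_mem M D hβ hc h.succ t).2

/-- Optimism. -/
theorem VStar_le_vHat (hβ : β ≠ 0) (hc : 0 ≤ c)
    (hD : IsConcentrated M D (relBonus A δ c K D)) (h : Fin (H + 1)) (s : S) :
    VStar M β h s ≤ vHat M β δ c K D h s := by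
  induction h using Fin.reverseInduction generalizing s with
  | last => rw [VStar_last M hβ, vHat_last]
  | cast i ih =>
    obtain ⟨a, ha⟩ := exists_QStar_eq_VStar M hβ i s
    rw [← ha, QStar_eq_backup M hβ]
    refine (backup_mono M hβ i s a ih).trans (le_trans ?_ (qHat_le_vHat M D i s a))
    exact (util_strictMono hβ).le_iff_le.1 (util_qHat_bounds M hβ hc hD i s a).1

end Tables

/-! ### Weights of the cascaded gaps -/

/-- The constant `β ψ_β`. -/
def kappa (H : ℕ) (β : ℝ) : ℝ := if 0 < β then 1 else Real.exp (-β * H)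

theorem kappa_pos (H : ℕ) (β : ℝ) : 0 < kappa H β := by
  rw [kappa]
  split_ifs
  · exact one_pos
  · exact Real.exp_pos _

theorem psi_eq_kappa_div (H : ℕ) (β : ℝ) : psi H β = kappa H β / β := by
  rw [psi, kappa]
  split_ifs <;> rfl

/-- Upper bound on the cascaded gaps. -/
def gapBound (H : ℕ) (β : ℝ) : ℝ := (Real.exp (|β| * H) - 1) / |β|

theorem le_gapBound (H : ℕ) {β : ℝ} (hβ : β ≠ 0) : (H : ℝ) ≤ gapBound H β := by
  rw [gapBound, le_div_iff₀ (abs_pos.2 hβ)]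
  linarith [Real.add_one_le_exp (|β| * H)]

section Weight

variable {S A : Type*} {H : ℕ} (M : MDP S A H) {β : ℝ}

/-- Reward collected along `τ` before step `h`. -/
def pastReward (h : Fin (H + 1)) (τ : Fin H → S × A) : ℝ :=
  ∑ j ∈ Finset.univ.filter (fun j : Fin H => j.castSucc < h), M.r j (τ j).1 (τ j).2

/-- The factor in front of the difference of utilities in a cascaded gap. -/
def weight (β : ℝ) (h : Fin (H + 1)) (τ : Fin H → S × A) : ℝ :=
  kappa H β * Real.exp (β * pastReward M h τ)

theorem weight_pos (h : Fin (H + 1)) (τ : Fin H → S × A) : 0 < weight M β h τ :=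
  mul_pos (kappa_pos _ _) (Real.exp_pos _)

theorem weight_zero (τ : Fin H → S × A) : weight M β 0 τ = kappa H β := by
  simp [weight, pastReward]

theorem pastReward_update (h : Fin H) (s : S) (a : A) (τ : Fin H → S × A) :
    pastReward M h.succ (Function.update τ h (s, a)) = pastReward M h.castSucc τ + M.r h s a := by
  have h1 : Finset.univ.filter (fun j : Fin H => j.castSucc < h.succ) =
      insert h (Finset.univ.filter fun j : Fin H => j.castSucc < h.castSucc) := by
    ext j
    simp only [Finset.mem_filter, Finset.mem_univ, true_and, Finset.mem_insert, Fin.lt_def,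
      Fin.ext_iff, Fin.val_castSucc, Fin.val_succ]
    omega
  rw [pastReward, h1, Finset.sum_insert (by simp), pastReward, add_comm]
  congr 1
  · refine Finset.sum_congr rfl fun j hj => ?_
    have : j ≠ h := by
      rintro rfl
      simp at hj
    rw [Function.update_of_ne this]
  · simp

theorem weight_update (h : Fin H) (s : S) (a : A) (τ : Fin H → S × A) :
    weight M β h.succ (Function.update τ h (s, a)) =
      weight M β h.castSucc τ * Real.exp (β * M.r h s a) := by
  rw [weight, weight, pastReward_update, mul_add, Real.exp_add, mul_assoc]

theorem pastReward_nonneg (h : Fin (H + 1)) (τ : Fin H → S × A) : 0 ≤ pastReward M h τ :=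
  Finset.sum_nonneg fun _ _ => (M.r_mem _ _ _).1

theorem pastReward_le (h : Fin H) (τ : Fin H → S × A) :
    pastReward M h.castSucc τ ≤ (h : ℕ) := by
  refine (Finset.sum_le_card_nsmul _ _ 1 fun j _ => (M.r_mem _ _ _).2).trans ?_
  rw [nsmul_eq_mul, mul_one]
  have : (Finset.univ.filter fun j : Fin H => j.castSucc < h.castSucc) = Finset.Iio h := by
    ext j
    simp
  rw [this, Fin.card_Iio]

/-- Past rewards lie in [0, h]. For `β > 0` the weight is at most e^{βh}, for `β < 0` at most
e^{|β|H}; in both cases the product is at most (e^{|β|H} - e^{|β|h})/|β|. -/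
theorem weight_mul_le_gapBound (hβ : β ≠ 0) (h : Fin H) (τ : Fin H → S × A) :
    weight M β h.castSucc τ * (util β ((H : ℝ) - (h : ℕ)) - util β 0) ≤ gapBound H β := by
  have hR0 := pastReward_nonneg M h.castSucc τ
  have hR1 := pastReward_le M h τ
  set R := pastReward M h.castSucc τ
  have hh : (0 : ℝ) ≤ (h : ℕ) := Nat.cast_nonneg _
  have hnn : 0 ≤ util β ((H : ℝ) - (h : ℕ)) - util β 0 :=
    sub_nonneg.2 ((util_strictMono hβ).monotone (by linarith [one_le_sub_val h]))
  rcases hβ.lt_or_gt with hneg | hpos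
  · have hw : weight M β h.castSucc τ ≤ Real.exp (-β * H) := by
      rw [weight, kappa, if_neg hneg.le.not_gt]
      refine mul_le_of_le_one_right (Real.exp_pos _).le (Real.exp_le_one_iff.2 ?_)
      exact mul_nonpos_of_nonpos_of_nonneg hneg.le hR0
    refine (mul_le_mul_of_nonneg_right hw hnn).trans ?_
    rw [gapBound, abs_of_neg hneg, util, util, mul_zero, Real.exp_zero, ← sub_div,
      le_div_iff₀ (neg_pos.2 hneg)]
    have e : Real.exp (-β * H) * ((Real.exp (β * ((H : ℝ) - (h : ℕ))) - 1) / β) * -β =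
        Real.exp (-β * H) - Real.exp (-β * H) * Real.exp (β * ((H : ℝ) - (h : ℕ))) := by
      field_simp
      ring
    rw [e, ← Real.exp_add, show -β * (H : ℝ) + β * ((H : ℝ) - (h : ℕ)) = -β * (h : ℕ) by ring]
    linarith [Real.one_le_exp (mul_nonneg (neg_pos.2 hneg).le hh)]
  · have hw : weight M β h.castSucc τ ≤ Real.exp (β * (h : ℕ)) := by
      rw [weight, kappa, if_pos hpos, one_mul]
      exact Real.exp_le_exp.2 (mul_le_mul_of_nonneg_left hR1 hpos.le)
    refine (mul_le_mul_of_nonneg_right hw hnn).trans ?_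
    rw [gapBound, abs_of_pos hpos, mul_sub, exp_mul_util, exp_mul_util, util, util, ← sub_div,
      add_sub_cancel, add_zero]
    refine div_le_div_of_nonneg_right ?_ hpos.le
    linarith [Real.one_le_exp (mul_nonneg hpos.le hh)]

variable [Fintype S]

theorem gap_eq (h : Fin H) (s : S) (a : A) (τ : Fin H → S × A) :
    gap M β h s a τ = weight M β h.castSucc τ *
      (util β (VStar M β h.castSucc s) - util β (QStar M β h s a)) := by
  simp only [gap, weight, pastReward, psi_eq_kappa_div, util, Fin.castSucc_lt_castSucc_iff]
  ring

variable [Fintype A] [Nonempty A]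

theorem gap_nonneg (hβ : β ≠ 0) (h : Fin H) (s : S) (a : A) (τ : Fin H → S × A) :
    0 ≤ gap M β h s a τ := by
  rw [gap_eq]
  exact mul_nonneg (weight_pos M _ _).le
    (sub_nonneg.2 ((util_strictMono hβ).monotone (QStar_le_VStar M hβ h s a)))

theorem gap_le_gapBound (hβ : β ≠ 0) (h : Fin H) (s : S) (a : A) (τ : Fin H → S × A) :
    gap M β h s a τ ≤ gapBound H β := by
  rw [gap_eq]
  refine le_trans (mul_le_mul_of_nonneg_left ?_ (weight_pos M _ _).le)
    (weight_mul_le_gapBound M hβ h τ)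
  have h1 := (util_strictMono hβ).monotone (VStar_le M hβ h.castSucc s)
  have h2 := (util_strictMono hβ).monotone (QStar_nonneg M hβ h s a)
  rw [Fin.val_castSucc] at h1
  linarith

theorem minGap_le_gap (hβ : β ≠ 0) (h : Fin H) (s : S) (a : A) (τ : Fin H → S × A)
    (hne : gap M β h s a τ ≠ 0) : minGap M β ≤ gap M β h s a τ := by
  refine csInf_le ⟨0, ?_⟩ ⟨hne, h, s, a, τ, rfl⟩
  rintro _ ⟨-, h, s, a, τ, rfl⟩
  exact gap_nonneg M hβ h s a τ

end Weight

/-! ### Regret of one episode on the concentration event -/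

/-- Charge for the visit that follows `n` earlier ones. -/
def visitCost (b B ε : ℝ) (n : ℕ) : ℝ := if n = 0 then B else min B (b * B ^ 2 / (ε * n))

theorem visitCost_nonneg {b B ε : ℝ} (hb : 0 ≤ b) (hB : 0 ≤ B) (hε : 0 < ε) (n : ℕ) :
    0 ≤ visitCost b B ε n := by
  rw [visitCost]
  split_ifs
  · exact hB
  · exact le_min hB (by positivity)

theorem visitCost_le {b B ε : ℝ} (n : ℕ) : visitCost b B ε n ≤ B := by
  rw [visitCost]
  split_ifs
  · exact le_rfl
  · exact min_le_left _ _

/-- This is 2x ≤ x²/ε + ε with x = B√(b/n). It trades a 1/√n rate for a summable-up-to-logarithm 1/n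
rate at the price of ε. -/
theorem mul_surplusRate_le {b B ε : ℝ} (hb : 0 ≤ b) (hB : 0 ≤ B) (hε : 0 < ε) (n : ℕ) :
    B * surplusRate b n ≤ visitCost b B ε n + ε := by
  rw [visitCost, surplusRate]
  split_ifs with hn
  · linarith
  · rw [← sub_le_iff_le_add]
    refine le_min ?_ ?_
    · have := mul_le_mul_of_nonneg_left (min_le_left 1 (2 * √(b / n))) hB
      linarith
    · have hn' : (0 : ℝ) < n := by exact_mod_cast Nat.pos_of_ne_zero hn
      have h1 := mul_le_mul_of_nonneg_left (min_le_right 1 (2 * √(b / n))) hB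
      refine (sub_le_sub_right h1 ε).trans ?_
      have h2 : b * B ^ 2 / (ε * n) = (B * √(b / n)) ^ 2 / ε := by
        rw [mul_pow, Real.sq_sqrt (by positivity)]
        field_simp
      rw [h2, le_div_iff₀ hε]
      nlinarith [sq_nonneg (B * √(b / n) - ε)]

theorem sum_visitCost_le {b B ε : ℝ} (hb : 0 ≤ b) (hB : 0 ≤ B) (hε : 0 < ε) {n K : ℕ}
    (hnK : n ≤ K) :
    ∑ i ∈ Finset.range n, visitCost b B ε i ≤ B + b * B ^ 2 / ε * (1 + Real.log K) := by
  rcases Nat.eq_zero_or_pos n with rfl | hn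
  · have : 0 ≤ Real.log K := Real.log_natCast_nonneg K
    simp only [Finset.range_zero, Finset.sum_empty]
    positivity
  · obtain ⟨m, rfl⟩ := Nat.exists_eq_succ_of_ne_zero hn.ne'
    have hK : (0 : ℝ) < (m.succ : ℕ) := by positivity
    rw [Finset.sum_range_succ', add_comm]
    refine add_le_add (by simp [visitCost]) ?_
    have h1 : ∑ i ∈ Finset.range m, visitCost b B ε (i + 1) ≤ b * B ^ 2 / ε * (harmonic m : ℝ) := by
      rw [harmonic, Rat.cast_sum, Finset.mul_sum]
      refine Finset.sum_le_sum fun i _ => ?_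
      rw [visitCost, if_neg i.succ_ne_zero]
      refine (min_le_right _ _).trans_eq ?_
      push_cast
      field_simp
    refine h1.trans (mul_le_mul_of_nonneg_left ?_ (by positivity))
    refine (harmonic_le_one_add_log m).trans (add_le_add le_rfl ?_)
    rcases Nat.eq_zero_or_pos m with rfl | hm
    · simpa using Real.log_natCast_nonneg K
    · exact Real.log_le_log (by exact_mod_cast hm) (by exact_mod_cast m.le_succ.trans hnK)

/-- The lossless one-step transfer: the discount-like factor `exp (β r)` of the backup is absorbed
when the current pair is written into `τ`. -/
theorem weight_mul_util_backup_sub {S A : Type*} [Fintype S] {H : ℕ} (M : MDP S A H)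
    {β : ℝ} (hβ : β ≠ 0) (h : Fin H) (s : S) (a : A) (τ : Fin H → S × A) (v w : S → ℝ) :
    weight M β h.castSucc τ * (util β (backup M β h s a v) - util β (backup M β h s a w)) =
      expect (M.P h s a) fun t => weight M β h.succ (Function.update τ h (s, a)) *
        (util β (v t) - util β (w t)) := by
  rw [util_backup' M hβ, util_backup' M hβ, expect_const_mul, expect_sub, weight_update]
  ring

section Episode

variable {S A : Type*} [Fintype S] [DecidableEq S] [DecidableEq A] [Fintype A] [Nonempty A] {H : ℕ}
  (M : MDP S A H) {k : ℕ} {D : Fin k → Episode S A H} {β δ c : ℝ} {K : ℕ} {π : Policy S A H}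

/-- Cost charged to a state at a step under the policy `π`. -/
def stateCost (f : ℕ → ℝ) (D : Fin k → Episode S A H) (π : Policy S A H) (h : Fin H) (s : S) : ℝ :=
  f (count D h s (π h s))

/-- Backward induction: each step contributes its weighted surplus, split into a charge and a slack
ε, and the rest transfers to the next state. The visit counts stay fixed during the episode. -/
theorem weight_mul_util_vHat_sub_le (hβ : β ≠ 0) (hc : 0 ≤ c)
    (hD : IsConcentrated M D (relBonus A δ c K D))
    (hπ : ∀ h s a, qHat M β δ c K D h s a ≤ qHat M β δ c K D h s (π h s))
    (hL : 0 ≤ Real.log (2 * Fintype.card S * Fintype.card A * H * K / δ)) {ε : ℝ} (hε : 0 < ε)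
    (h : Fin (H + 1)) (s : S) (τ : Fin H → S × A) :
    weight M β h τ * (util β (vHat M β δ c K D h s) - util β (V M β π h s)) ≤
      costToGo M π (stateCost (visitCost (c ^ 2 * ((Fintype.card S : ℝ) *
        Real.log (2 * Fintype.card S * Fintype.card A * H * K / δ))) (gapBound H β) ε) D π) h s +
      ((H : ℝ) - (h : ℕ)) * ε := by
  set b := c ^ 2 * ((Fintype.card S : ℝ) *
    Real.log (2 * Fintype.card S * Fintype.card A * H * K / δ))
  have hb : 0 ≤ b := by positivity
  have hB : 0 ≤ gapBound H β := (Nat.cast_nonneg H).trans (le_gapBound H hβ)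
  induction h using Fin.reverseInduction generalizing s τ with
  | last => simp [vHat_last, V_last, costToGo_last]
  | cast i ih =>
    have hv : vHat M β δ c K D i.castSucc s = qHat M β δ c K D i s (π i s) :=
      le_antisymm (vHat_castSucc M D i s ▸ ciSup_le (hπ i s)) (qHat_le_vHat M D i s _)
    have hq := (util_qHat_bounds M hβ hc hD i s (π i s)).2
    rw [hv, V_castSucc M hβ, costToGo_castSucc]
    have hw := weight_pos M (β := β) i.castSucc τ
    have h1 := mul_le_mul_of_nonneg_left hq hw.le
    have h2 := weight_mul_le_gapBound M hβ i τ
    have hr : 0 ≤ surplusRate b (count D i s (π i s)) := by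
      rw [surplusRate]
      split_ifs
      · exact zero_le_one
      · positivity
    have h3 := (mul_le_mul_of_nonneg_right h2 hr).trans (mul_surplusRate_le hb hB hε _)
    have h4 := weight_mul_util_backup_sub M hβ i s (π i s) τ
      (vHat M β δ c K D i.succ) (V M β π i.succ)
    have h5 := expect_mono (M.P i s (π i s)) fun t => ih t (Function.update τ i (s, π i s))
    rw [← h4, expect_add, expect_const, sub_val_succ] at h5
    rw [Fin.val_castSucc]
    simp only [stateCost] at *
    linarith

/-- Regret in weighted utility is at most twice the expected cost: if the gap at the current step
vanishes, nothing is lost there, and otherwise the loss dominates the slack of the clipping. -/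
theorem weight_mul_util_VStar_sub_le (hβ : β ≠ 0) (hc : 0 ≤ c)
    (hD : IsConcentrated M D (relBonus A δ c K D))
    (hπ : ∀ h s a, qHat M β δ c K D h s a ≤ qHat M β δ c K D h s (π h s))
    (hL : 0 ≤ Real.log (2 * Fintype.card S * Fintype.card A * H * K / δ))
    (hΔ : 0 < minGap M β) (hH : 1 ≤ H) (h : Fin (H + 1)) (s : S) (τ : Fin H → S × A) :
    weight M β h τ * (util β (VStar M β h s) - util β (V M β π h s)) ≤
      2 * costToGo M π (stateCost (visitCost (c ^ 2 * ((Fintype.card S : ℝ) *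
        Real.log (2 * Fintype.card S * Fintype.card A * H * K / δ))) (gapBound H β)
        (minGap M β / (2 * H))) D π) h s := by
  have hH' : (0 : ℝ) < H := by exact_mod_cast hH
  have hε : 0 < minGap M β / (2 * H) := by positivity
  have hopt := weight_mul_util_vHat_sub_le M hβ hc hD hπ hL hε
  set b := c ^ 2 * ((Fintype.card S : ℝ) *
    Real.log (2 * Fintype.card S * Fintype.card A * H * K / δ))
  have hb : 0 ≤ b := by positivity
  have hB : 0 ≤ gapBound H β := (Nat.cast_nonneg H).trans (le_gapBound H hβ)
  have hmono := (util_strictMono hβ).monotone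
  induction h using Fin.reverseInduction generalizing s τ with
  | last => simp [VStar_last M hβ, V_last, costToGo_last]
  | cast i ih =>
    have hw := weight_pos M (β := β) i.castSucc τ
    by_cases hg : gap M β i s (π i s) τ = 0
    · have h0 : util β (VStar M β i.castSucc s) = util β (QStar M β i s (π i s)) := by
        rw [gap_eq] at hg
        exact sub_eq_zero.1 ((mul_eq_zero.1 hg).resolve_left hw.ne')
      rw [h0, QStar_eq_backup M hβ, V_castSucc M hβ, costToGo_castSucc,
        weight_mul_util_backup_sub M hβ]
      have h5 := expect_mono (M.P i s (π i s)) fun t => ih t (Function.update τ i (s, π i s))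
      rw [expect_const_mul _ 2] at h5
      have := visitCost_nonneg hb hB hε (count D i s (π i s))
      simp only [stateCost] at *
      linarith
    · have h1 := minGap_le_gap M hβ i s (π i s) τ hg
      have h2 : gap M β i s (π i s) τ ≤ weight M β i.castSucc τ *
          (util β (VStar M β i.castSucc s) - util β (V M β π i.castSucc s)) := by
        rw [gap_eq]
        refine mul_le_mul_of_nonneg_left ?_ hw.le
        have h3 : V M β π i.castSucc s ≤ QStar M β i s (π i s) := by
          rw [V_castSucc M hβ, QStar_eq_backup M hβ]
          exact backup_mono M hβ _ _ _ fun t => V_le_VStar M hβ π _ t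
        linarith [hmono h3]
      have h4 := hopt i.castSucc s τ
      have h5 : weight M β i.castSucc τ *
          (util β (VStar M β i.castSucc s) - util β (V M β π i.castSucc s)) ≤
          weight M β i.castSucc τ *
          (util β (vHat M β δ c K D i.castSucc s) - util β (V M β π i.castSucc s)) :=
        mul_le_mul_of_nonneg_left
          (sub_le_sub_right (hmono (VStar_le_vHat M hβ hc hD i.castSucc s)) _) hw.le
      -- The accumulated slack is at most half the minimal gap, hence at most half the loss, and is
      -- absorbed on the left; this is the origin of the factor 2.
      have h6 : ((H : ℝ) - (i.castSucc : ℕ)) * (minGap M β / (2 * H)) ≤ minGap M β / 2 := by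
        rw [show minGap M β / 2 = (H : ℝ) * (minGap M β / (2 * H)) by field_simp]
        refine mul_le_mul_of_nonneg_right ?_ hε.le
        linarith [Nat.cast_nonneg (α := ℝ) (i.castSucc : ℕ)]
      linarith

/-- At the first step the weight is `kappa`, chosen so that `kappa * exp (β v) ≥ 1` for all `v` in
[0, H]; thus weighted utility differences dominate value differences. -/
theorem VStar_sub_V_le (hβ : β ≠ 0) (hc : 0 ≤ c)
    (hD : IsConcentrated M D (relBonus A δ c K D))
    (hπ : ∀ h s a, qHat M β δ c K D h s a ≤ qHat M β δ c K D h s (π h s))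
    (hL : 0 ≤ Real.log (2 * Fintype.card S * Fintype.card A * H * K / δ))
    (hΔ : 0 < minGap M β) (hH : 1 ≤ H) :
    VStar M β 0 M.s₁ - V M β π 0 M.s₁ ≤
      2 * costToGo M π (stateCost (visitCost (c ^ 2 * ((Fintype.card S : ℝ) *
        Real.log (2 * Fintype.card S * Fintype.card A * H * K / δ))) (gapBound H β)
        (minGap M β / (2 * H))) D π) 0 M.s₁ := by
  have hle := V_le_VStar M hβ π 0 M.s₁
  refine le_trans ?_ (weight_mul_util_VStar_sub_le M hβ hc hD hπ hL hΔ hH 0 M.s₁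
    fun _ => (M.s₁, Classical.arbitrary A))
  rw [weight_zero]
  refine le_trans ?_ (mul_le_mul_of_nonneg_left (min_exp_mul_sub_le_util_sub hβ hle)
    (kappa_pos H β).le)
  rw [← mul_assoc]
  refine le_mul_of_one_le_left (sub_nonneg.2 hle) ?_
  have h0 := VStar_nonneg M hβ 0 M.s₁
  have h1 := VStar_le M hβ 0 M.s₁
  have h2 := V_nonneg M hβ π 0 M.s₁
  have h3 := V_le M hβ π 0 M.s₁
  simp only [Fin.val_zero, Nat.cast_zero, sub_zero] at h1 h3
  rw [mul_min_of_nonneg _ _ (kappa_pos H β).le, kappa]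
  split_ifs with hpos
  · rw [one_mul, one_mul]
    exact le_min (Real.one_le_exp (mul_nonneg hpos.le h0)) (Real.one_le_exp (mul_nonneg hpos.le h2))
  · rw [← Real.exp_add, ← Real.exp_add]
    refine le_min (Real.one_le_exp ?_) (Real.one_le_exp ?_) <;> nlinarith

end Episode

/-! ### Exponential moments -/

theorem exp_mul_le_cosh_add_mul_sinh (l : ℝ) {x : ℝ} (h0 : -1 ≤ x) (h1 : x ≤ 1) :
    Real.exp (l * x) ≤ Real.cosh l + x * Real.sinh l := by
  have ha : 0 ≤ (1 + x) / 2 := by linarith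
  have hb : 0 ≤ (1 - x) / 2 := by linarith
  have h := convexOn_exp.2 (Set.mem_univ l) (Set.mem_univ (-l)) ha hb (by ring)
  simp only [smul_eq_mul] at h
  rw [show (1 + x) / 2 * l + (1 - x) / 2 * -l = l * x by ring] at h
  rw [Real.cosh_eq, Real.sinh_eq]
  linarith

/-- Hoeffding's lemma with the cruder constant 1/2: the centred variable is only used to lie in [-1,
1]. -/
theorem expect_exp_centered_le {Ω : Type*} [Fintype Ω] (p : PMF Ω) {f : Ω → ℝ}
    (h0 : ∀ ω, 0 ≤ f ω) (h1 : ∀ ω, f ω ≤ 1) (l : ℝ) :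
    expect p (fun ω => Real.exp (l * (f ω - expect p f))) ≤ Real.exp (l ^ 2 / 2) := by
  have e0 : 0 ≤ expect p f := le_expect_of_le _ h0
  have e1 : expect p f ≤ 1 := expect_le_of_le _ h1
  refine le_trans (expect_mono p fun ω => exp_mul_le_cosh_add_mul_sinh l (by linarith [h0 ω])
    (by linarith [h1 ω])) ?_
  refine le_trans (le_of_eq ?_) (Real.cosh_le_exp_half_sq l)
  simp only [mul_comm _ (Real.sinh l), expect_add, expect_const, expect_const_mul, expect_sub]
  ring

/-- Uses e^{-y} ≤ 1 - y/2 on [0, 1]. Nonnegativity gives a multiplicative deviation bound, with no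
variance term. -/
theorem expect_exp_neg_div_le {Ω : Type*} [Fintype Ω] (p : PMF Ω) {f : Ω → ℝ} {b : ℝ} (hb : 0 < b)
    (h0 : ∀ ω, 0 ≤ f ω) (h1 : ∀ ω, f ω ≤ b) :
    expect p (fun ω => Real.exp (-(f ω / b))) ≤ Real.exp (-(expect p f / 2 / b)) := by
  have key (y : ℝ) (hy0 : 0 ≤ y) (hy1 : y ≤ 1) : Real.exp (-y) ≤ 1 + (-1 / 2) * y := by
    rw [Real.exp_neg, inv_le_iff_one_le_mul₀' (Real.exp_pos y)]
    have := mul_le_mul_of_nonneg_right (Real.add_one_le_exp y)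
      (show 0 ≤ 1 + (-1 / 2) * y by linarith)
    nlinarith
  refine (expect_mono p fun ω => key _ (div_nonneg (h0 ω) hb.le)
    (div_le_one_of_le₀ (h1 ω) hb.le)).trans ?_
  rw [expect_add, expect_const, expect_const_mul, expect_div_const]
  refine le_trans (le_of_eq ?_) (Real.add_one_le_exp _)
  ring

/-! ### Probability that concentration fails. -/

section Learning

variable {S A : Type*} [DecidableEq S] [DecidableEq A] {H : ℕ} {k : ℕ} (D : Fin k → Episode S A H)
  (e : Episode S A H)

theorem sum_visits_snoc (φ : Episode S A H → ℝ) (h : Fin H) (s : S) (a : A) :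
    ∑ i ∈ visits (Fin.snoc (α := fun _ => Episode S A H) D e) h s a,
        φ (Fin.snoc (α := fun _ => Episode S A H) D e i) =
      ∑ i ∈ visits D h s a, φ (D i) + if e.1 h.castSucc = s ∧ e.2 h = a then φ e else 0 := by
  simp only [visits, Finset.sum_filter, Fin.sum_univ_castSucc, Fin.snoc_castSucc, Fin.snoc_last]

theorem count_snoc (h : Fin H) (s : S) (a : A) :
    count (Fin.snoc (α := fun _ => Episode S A H) D e) h s a =
      count D h s a + if e.1 h.castSucc = s ∧ e.2 h = a then 1 else 0 := by
  simp only [count, visits, Finset.card_filter, Fin.sum_univ_castSucc, Fin.snoc_castSucc,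
    Fin.snoc_last]

theorem count_le (h : Fin H) (s : S) (a : A) : count D h s a ≤ k :=
  (Finset.card_le_univ _).trans_eq (Fintype.card_fin k)

variable [Fintype S] (M : MDP S A H)

/-- Exponential process controlling the deviations of `f` at the pair `(s, a)`. -/
def expDeviation (l : ℝ) (h : Fin H) (s : S) (a : A) (f : S → ℝ) : ℝ :=
  Real.exp (l * deviation M D h s a f - l ^ 2 / 2 * count D h s a)

theorem expDeviation_snoc (l : ℝ) (h : Fin H) (s : S) (a : A) (f : S → ℝ) :
    expDeviation (Fin.snoc (α := fun _ => Episode S A H) D e) M l h s a f =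
      expDeviation D M l h s a f * if e.1 h.castSucc = s ∧ e.2 h = a then
        Real.exp (l * (f (e.1 h.succ) - expect (M.P h s a) f)) * Real.exp (-(l ^ 2 / 2)) else 1 := by
  rw [expDeviation, deviation,
    sum_visits_snoc D e (fun x => f (x.1 h.succ) - expect (M.P h s a) f), count_snoc, expDeviation]
  split_ifs
  · rw [← Real.exp_add, ← Real.exp_add, deviation]
    congr 1
    push_cast
    ring
  · simp [deviation]

variable [Fintype A] (alg : Learner S A H)

/-- A supermartingale: an episode that visits the pair multiplies the process by a factor of
conditional mean at most 1, and any other episode leaves it unchanged. -/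
theorem expect_expDeviation_le_one (l : ℝ) (h : Fin H) (s : S) (a : A) {f : S → ℝ}
    (h0 : ∀ t, 0 ≤ f t) (h1 : ∀ t, f t ≤ 1) (k : ℕ) :
    expect (runLaw M alg k) (fun D => expDeviation D M l h s a f) ≤ 1 := by
  induction k with
  | zero =>
    rw [expect_runLaw_zero]
    simp [expDeviation, deviation, visits, count]
  | succ k ih =>
    rw [expect_runLaw_succ]
    refine le_trans (expect_mono _ fun D => ?_) ih
    simp only [expDeviation_snoc, expect_const_mul]
    refine mul_le_of_le_one_right (Real.exp_pos _).le ?_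
    rw [expect_episodeLaw]
    set π := alg k D
    refine expect_transition_le M π (h := h) (g := fun x y => if x = s ∧ π h x = a then
        Real.exp (l * (f y - expect (M.P h s a) f)) * Real.exp (-(l ^ 2 / 2)) else 1)
      (fun x => ?_) 0 (Fin.zero_le _) M.s₁
    by_cases hx : x = s ∧ π h x = a
    · simp only [if_pos hx, mul_comm _ (Real.exp (-(l ^ 2 / 2))), expect_const_mul]
      rw [hx.2, hx.1]
      refine (mul_le_mul_of_nonneg_left (expect_exp_centered_le (M.P h s a) h0 h1 l)
        (Real.exp_pos _).le).trans_eq ?_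
      rw [← Real.exp_add, neg_add_cancel, Real.exp_zero]
    · simp only [if_neg hx, expect_const, le_refl]

/-- Sum of exponential processes that exceeds `1` on records without concentration. -/
def failureBound (M : MDP S A H) (δ c : ℝ) (K : ℕ) (k : ℕ) (D : Fin k → Episode S A H) : ℝ :=
  ∑ h : Fin H, ∑ s : S, ∑ a : A, ∑ U : Finset S, ∑ n ∈ Finset.range K,
    Real.exp (-(c ^ 2 / 2 * ((Fintype.card S : ℝ) *
        Real.log (2 * Fintype.card S * Fintype.card A * H * K / δ)))) *
      expDeviation D M (c * √((Fintype.card S : ℝ) *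
        Real.log (2 * Fintype.card S * Fintype.card A * H * K / δ) / (n : ℝ)))
        h s a (fun t => if t ∈ U then 1 else 0)

variable {M} {D} {δ c : ℝ} {K : ℕ}

theorem failureBound_nonneg : 0 ≤ failureBound M δ c K k D := by
  unfold failureBound
  refine Finset.sum_nonneg fun _ _ => Finset.sum_nonneg fun _ _ => Finset.sum_nonneg fun _ _ =>
    Finset.sum_nonneg fun _ _ => Finset.sum_nonneg fun _ _ => ?_
  exact mul_nonneg (Real.exp_pos _).le (Real.exp_pos _).le

/-- If an event violates concentration after n visits, then the single summand tuned to that n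
already reaches 1. Summing over n avoids any stopping-time argument. -/
theorem isConcentrated_of_failureBound_lt_one (hc : 0 ≤ c) (hk : k < K)
    (hL : 0 ≤ Real.log (2 * Fintype.card S * Fintype.card A * H * K / δ))
    (hD : failureBound M δ c K k D < 1) : IsConcentrated M D (relBonus A δ c K D) := by
  intro h s a U
  by_contra! hlt
  refine hD.not_ge ?_
  set f : S → ℝ := fun t => if t ∈ U then 1 else 0
  set L := Real.log (2 * Fintype.card S * Fintype.card A * H * K / δ)
  have hN : count D h s a ≠ 0 := by
    intro h0
    rw [h0, deviation, Finset.card_eq_zero.1 h0] at hlt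
    simp at hlt
  have hN' : (0 : ℝ) < count D h s a := by exact_mod_cast Nat.pos_of_ne_zero hN
  -- The exponent l·x - l²n/2 is maximal at l = x/n, which at the threshold is the relative bonus
  -- itself.
  set l := c * √((Fintype.card S : ℝ) * L / (count D h s a : ℝ)) with hl
  have hl0 : 0 ≤ l := by positivity
  have hl2 : l ^ 2 * count D h s a = c ^ 2 * ((Fintype.card S : ℝ) * L) := by
    rw [hl, mul_pow, Real.sq_sqrt (by positivity)]
    field_simp
  have hone : 1 ≤ Real.exp (-(c ^ 2 / 2 * ((Fintype.card S : ℝ) * L))) *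
      expDeviation D M l h s a f := by
    rw [expDeviation, ← Real.exp_add]
    refine Real.one_le_exp ?_
    have h1 : l * (count D h s a * l) ≤ l * deviation M D h s a f :=
      mul_le_mul_of_nonneg_left hlt.le hl0
    nlinarith
  refine hone.trans ?_
  have hnn (h : Fin H) (s : S) (a : A) (U : Finset S) (n : ℕ) :
      0 ≤ Real.exp (-(c ^ 2 / 2 * ((Fintype.card S : ℝ) * L))) *
        expDeviation D M (c * √((Fintype.card S : ℝ) * L / (n : ℝ))) h s a
          (fun t => if t ∈ U then 1 else 0) :=
    mul_nonneg (Real.exp_pos _).le (Real.exp_pos _).le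
  unfold failureBound
  refine le_trans ?_ (Finset.single_le_sum (fun h _ => Finset.sum_nonneg fun s _ =>
    Finset.sum_nonneg fun a _ => Finset.sum_nonneg fun U _ => Finset.sum_nonneg fun n _ =>
      hnn h s a U n) (Finset.mem_univ h))
  refine le_trans ?_ (Finset.single_le_sum (fun s _ => Finset.sum_nonneg fun a _ =>
    Finset.sum_nonneg fun U _ => Finset.sum_nonneg fun n _ => hnn h s a U n) (Finset.mem_univ s))
  refine le_trans ?_ (Finset.single_le_sum (fun a _ => Finset.sum_nonneg fun U _ =>
    Finset.sum_nonneg fun n _ => hnn h s a U n) (Finset.mem_univ a))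
  refine le_trans ?_ (Finset.single_le_sum (fun U _ => Finset.sum_nonneg fun n _ =>
    hnn h s a U n) (Finset.mem_univ U))
  exact Finset.single_le_sum (f := fun n : ℕ =>
    Real.exp (-(c ^ 2 / 2 * ((Fintype.card S : ℝ) * L))) *
      expDeviation D M (c * √((Fintype.card S : ℝ) * L / (n : ℝ))) h s a
        (fun t => if t ∈ U then 1 else 0)) (fun n _ => hnn h s a U n)
    (Finset.mem_range.2 ((count_le D h s a).trans_lt hk))

variable (M)

theorem expect_failureBound_le (k : ℕ) :
    expect (runLaw M alg k) (failureBound M δ c K k) ≤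
      H * Fintype.card S * Fintype.card A * 2 ^ Fintype.card S * K *
        Real.exp (-(c ^ 2 / 2 * ((Fintype.card S : ℝ) *
        Real.log (2 * Fintype.card S * Fintype.card A * H * K / δ)))) := by
  unfold failureBound
  simp only [expect_sum, expect_const_mul]
  set x := Real.exp (-(c ^ 2 / 2 * ((Fintype.card S : ℝ) *
        Real.log (2 * Fintype.card S * Fintype.card A * H * K / δ))))
  refine le_trans (Finset.sum_le_sum fun h _ => Finset.sum_le_sum fun s _ =>
    Finset.sum_le_sum fun a _ => Finset.sum_le_sum fun U _ => Finset.sum_le_sum fun n _ =>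
      mul_le_mul_of_nonneg_left (expect_expDeviation_le_one M alg _ h s a
        (f := fun t => if t ∈ U then 1 else 0) (fun t => by split_ifs <;> norm_num)
        (fun t => by split_ifs <;> norm_num) k) (Real.exp_pos _).le) (le_of_eq ?_)
  simp only [mul_one, Finset.sum_const, Finset.card_univ, Fintype.card_fin, Fintype.card_finset,
    nsmul_eq_mul, Finset.card_range, Nat.cast_pow, Nat.cast_ofNat]
  ring

/-- With x = 2SAHK/δ, the condition `3 ≤ c` gives c²/2 ≥ 4, so the exponential beats 2^S ≤ x^S and
leaves x⁻³. The remaining union over steps, pairs, counts and episodes costs at most x². -/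
theorem expect_sumEarlier_failureBound_le (hS : 1 ≤ Fintype.card S) (hA : 1 ≤ Fintype.card A)
    (hH : 1 ≤ H) (hK : 1 ≤ K) (hδ0 : 0 < δ) (hδ1 : δ ≤ 1) (hc : 3 ≤ c) :
    expect (runLaw M alg K) (sumEarlier (failureBound M δ c K)) ≤
      δ / (2 * Fintype.card S * Fintype.card A * H * K) := by
  rw [expect_sumEarlier]
  refine (Finset.sum_le_sum fun (k : Fin K) _ =>
    expect_failureBound_le (δ := δ) (c := c) (K := K) M alg k).trans ?_
  rw [Finset.sum_const, Finset.card_univ, Fintype.card_fin, nsmul_eq_mul]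
  have hS' : (1 : ℝ) ≤ Fintype.card S := by exact_mod_cast hS
  have hA' : (1 : ℝ) ≤ Fintype.card A := by exact_mod_cast hA
  have hH' : (1 : ℝ) ≤ H := by exact_mod_cast hH
  have hK' : (1 : ℝ) ≤ K := by exact_mod_cast hK
  set s : ℝ := (Fintype.card S : ℝ)
  set a : ℝ := (Fintype.card A : ℝ)
  set x := 2 * s * a * H * K / δ with hx
  have hsa : 1 ≤ s * a := one_le_mul_of_one_le_of_one_le hS' hA'
  have hsah : 1 ≤ s * a * H := one_le_mul_of_one_le_of_one_le hsa hH'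
  have hsahk : 1 ≤ s * a * H * K := one_le_mul_of_one_le_of_one_le hsah hK'
  have hxge : 2 * (s * a * H * K) ≤ x := by
    rw [hx, le_div_iff₀ hδ0]
    nlinarith
  have hx2 : 2 ≤ x := by linarith
  have hx0 : 0 < x := by linarith
  have hL : Real.log 2 ≤ Real.log x := Real.log_le_log two_pos hx2
  have hL0 : 0 ≤ Real.log x := (Real.log_nonneg one_le_two).trans hL
  have h2 : (2 : ℝ) ^ Fintype.card S ≤ Real.exp (s * Real.log x) := by
    rw [← Real.exp_log (pow_pos two_pos _), Real.log_pow]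
    exact Real.exp_le_exp.2 (mul_le_mul_of_nonneg_left hL (by linarith))
  have h3 : Real.exp (s * Real.log x) * Real.exp (-(c ^ 2 / 2 * (s * Real.log x))) ≤ (x ^ 3)⁻¹ := by
    rw [← Real.exp_log (pow_pos hx0 3), ← Real.exp_neg, ← Real.exp_add, Real.log_pow]
    refine Real.exp_le_exp.2 ?_
    push_cast
    have h4 : Real.log x ≤ s * Real.log x := le_mul_of_one_le_left hL0 hS'
    have h5 : 0 ≤ (c ^ 2 / 2 - 4) * (s * Real.log x) :=
      mul_nonneg (by nlinarith) (hL0.trans h4)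
    linarith
  have h6 : (H * s * a * K) * K ≤ x ^ 2 := by
    have h7 : H * s * a * K ≤ x := by linarith
    have h8 : (K : ℝ) ≤ x := by nlinarith
    rw [sq]
    exact mul_le_mul h7 h8 (by linarith) hx0.le
  calc (K : ℝ) * (H * s * a * 2 ^ Fintype.card S * K * Real.exp (-(c ^ 2 / 2 * (s * Real.log x))))
      = (H * s * a * K) * K * (2 ^ Fintype.card S * Real.exp (-(c ^ 2 / 2 * (s * Real.log x)))) := by
        ring
    _ ≤ x ^ 2 * (x ^ 3)⁻¹ := by
        refine mul_le_mul h6 ((mul_le_mul_of_nonneg_right h2 (Real.exp_pos _).le).trans h3)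
          (by positivity) (by positivity)
    _ = x⁻¹ := by field_simp
    _ = δ / (2 * s * a * H * K) := by rw [hx, inv_div]

/-! ### The visit potential -/

variable (D)

/-- Total charge of all visits in a record. -/
def visitPotential (f : ℕ → ℝ) {k : ℕ} (D : Fin k → Episode S A H) : ℝ :=
  ∑ h : Fin H, ∑ s : S, ∑ a : A, ∑ n ∈ Finset.range (count D h s a), f n

theorem visitPotential_snoc (f : ℕ → ℝ) :
    visitPotential f (Fin.snoc (α := fun _ => Episode S A H) D e) =
      visitPotential f D + ∑ h, f (count D h (e.1 h.castSucc) (e.2 h)) := by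
  have key (h : Fin H) (s : S) (a : A) :
      ∑ n ∈ Finset.range (count (Fin.snoc (α := fun _ => Episode S A H) D e) h s a), f n =
        ∑ n ∈ Finset.range (count D h s a), f n +
          if e.1 h.castSucc = s then (if e.2 h = a then f (count D h s a) else 0) else 0 := by
    rw [count_snoc, ← ite_and]
    split_ifs
    · rw [Finset.sum_range_succ]
    · simp
  simp only [visitPotential, key, Finset.sum_add_distrib]
  congr 1
  refine Finset.sum_congr rfl fun h _ => ?_
  rw [Finset.sum_comm]
  simp

theorem visitPotential_le {f : ℕ → ℝ} {y : ℝ} (hf : ∀ n ≤ k, ∑ i ∈ Finset.range n, f i ≤ y) :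
    visitPotential f D ≤ H * Fintype.card S * Fintype.card A * y := by
  unfold visitPotential
  refine le_trans (Finset.sum_le_sum fun h _ => Finset.sum_le_sum fun s _ =>
    Finset.sum_le_sum fun a _ => hf _ (count_le D h s a)) (le_of_eq ?_)
  simp only [Finset.sum_const, Finset.card_univ, Fintype.card_fin, nsmul_eq_mul]
  ring

/-- Expected charge of the next episode. -/
def episodeCost (f : ℕ → ℝ) (k : ℕ) (D : Fin k → Episode S A H) : ℝ :=
  costToGo M (alg k D) (stateCost f D (alg k D)) 0 M.s₁

theorem episodeCost_eq (f : ℕ → ℝ) :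
    episodeCost M alg f k D = expect (episodeLaw M (alg k D)) fun e =>
      ∑ h, f (count D h (e.1 h.castSucc) (e.2 h)) := by
  rw [episodeCost, costToGo_zero, expect_episodeLaw]
  rfl

/-- The potential minus the accumulated conditional charges is a martingale. -/
theorem expect_sumEarlier_episodeCost (f : ℕ → ℝ) (K : ℕ) :
    expect (runLaw M alg K) (sumEarlier (episodeCost M alg f)) =
      expect (runLaw M alg K) (visitPotential f) := by
  induction K with
  | zero => simp [expect_runLaw_zero, sumEarlier, visitPotential, count, visits]
  | succ K ih =>
    rw [expect_runLaw_succ, expect_runLaw_succ]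
    simp only [sumEarlier_snoc, visitPotential_snoc, expect_add, expect_const, ih]
    exact congrArg _ (congrArg _ (funext fun D => episodeCost_eq M alg f (D := D)))

/-- The charges of one episode lie in [0, HB], so `expect_exp_neg_div_le` applies conditionally.
Half of the conditional mean is what compensates each increment. -/
theorem expect_exp_sumEarlier_sub_visitPotential_le_one {f : ℕ → ℝ} {B : ℝ} (hB : 0 < B)
    (h0 : ∀ n, 0 ≤ f n) (h1 : ∀ n, f n ≤ B) (hH : 1 ≤ H) (K : ℕ) :
    expect (runLaw M alg K) (fun D => Real.exp
      ((sumEarlier (episodeCost M alg f) D / 2 - visitPotential f D) / (H * B))) ≤ 1 := by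
  have hHB : 0 < H * B := mul_pos (by exact_mod_cast hH) hB
  induction K with
  | zero => simp [expect_runLaw_zero, sumEarlier, visitPotential, count, visits]
  | succ K ih =>
    rw [expect_runLaw_succ]
    refine le_trans (expect_mono _ fun D => ?_) ih
    simp only [sumEarlier_snoc, visitPotential_snoc]
    set X : Episode S A H → ℝ := fun e => ∑ h, f (count D h (e.1 h.castSucc) (e.2 h)) with hX
    have hX0 (e : Episode S A H) : 0 ≤ X e := Finset.sum_nonneg fun _ _ => h0 _
    have hX1 (e : Episode S A H) : X e ≤ H * B := by
      refine (Finset.sum_le_card_nsmul _ _ B fun _ _ => h1 _).trans_eq ?_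
      simp
    have hE := expect_exp_neg_div_le (episodeLaw M (alg K D)) hHB hX0 hX1
    rw [← episodeCost_eq] at hE
    have hsplit (e : Episode S A H) : Real.exp
        (((sumEarlier (episodeCost M alg f) D + episodeCost M alg f K D) / 2 -
          (visitPotential f D + X e)) / (H * B)) =
        Real.exp ((sumEarlier (episodeCost M alg f) D / 2 - visitPotential f D) / (H * B)) *
          Real.exp (episodeCost M alg f K D / 2 / (H * B)) * Real.exp (-(X e / (H * B))) := by
      rw [← Real.exp_add, ← Real.exp_add]
      congr 1
      ring
    refine le_of_eq_of_le (congrArg _ (funext hsplit)) ?_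
    rw [expect_const_mul, mul_assoc]
    refine mul_le_of_le_one_right (Real.exp_pos _).le ?_
    refine (mul_le_mul_of_nonneg_left hE (Real.exp_pos _).le).trans_eq ?_
    rw [← Real.exp_add, add_neg_cancel, Real.exp_zero]

end Learning

/-! ### Total regret -/

theorem gapBound_sq (H : ℕ) (β : ℝ) :
    gapBound H β ^ 2 = (Real.exp (|β| * H) - 1) ^ 2 / |β| ^ 2 := div_pow _ _ _

section Regret

variable {S A : Type*} [Fintype S] [Fintype A] {H : ℕ} (M : MDP S A H) {β : ℝ}

theorem exists_gap_ne_zero (hΔ : 0 < minGap M β) : ∃ h s a τ, gap M β h s a τ ≠ 0 := by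
  by_contra! hall
  have : {x : ℝ | x ≠ 0 ∧ ∃ h s a τ, x = gap M β h s a τ} = ∅ := by
    ext x
    simp only [Set.mem_ofPred_eq, Set.mem_empty_iff_false, iff_false, not_and]
    rintro hx ⟨h, s, a, τ, rfl⟩
    exact hx (hall h s a τ)
  rw [minGap, this, Real.sInf_empty] at hΔ
  exact lt_irrefl _ hΔ

theorem minGap_le_gapBound (hβ : β ≠ 0) (hΔ : 0 < minGap M β) : minGap M β ≤ gapBound H β := by
  obtain ⟨h, s, a, τ, hne⟩ := exists_gap_ne_zero M hΔ
  have : Nonempty A := ⟨a⟩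
  exact (minGap_le_gap M hβ h s a τ hne).trans (gap_le_gapBound M hβ h s a τ)

/-- A nonzero gap needs a suboptimal action besides an optimal one. This keeps the logarithm in the
final bounds at least log 2, so additive constants can be absorbed. -/
theorem two_le_card_action (hβ : β ≠ 0) (hΔ : 0 < minGap M β) : 2 ≤ Fintype.card A := by
  obtain ⟨h, s, a, τ, hne⟩ := exists_gap_ne_zero M hΔ
  have : Nonempty A := ⟨a⟩
  obtain ⟨a', ha'⟩ := exists_QStar_eq_VStar M hβ h s
  refine Fintype.one_lt_card_iff.2 ⟨a, a', ?_⟩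
  rintro rfl
  exact hne (by rw [gap_eq, ha', sub_self, mul_zero])

theorem mul_gapBound_le (hβ : β ≠ 0) (hΔ : 0 < minGap M β) (hH : 1 ≤ H) :
    H * gapBound H β ≤ gapBound H β ^ 2 * (H : ℝ) ^ 3 * (Fintype.card S : ℝ) ^ 2 *
      (Fintype.card A : ℝ) / minGap M β := by
  have hH' : (1 : ℝ) ≤ H := by exact_mod_cast hH
  have hS : (1 : ℝ) ≤ (Fintype.card S : ℝ) ^ 2 :=
    one_le_pow₀ (by exact_mod_cast Fintype.card_pos_iff.2 ⟨M.s₁⟩)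
  have hA : (1 : ℝ) ≤ Fintype.card A := by exact_mod_cast one_le_two.trans (two_le_card_action M hβ hΔ)
  have hB : 0 < gapBound H β := by linarith [le_gapBound H hβ]
  have hΔB := minGap_le_gapBound M hβ hΔ
  have hh1 : (H : ℝ) ≤ (H : ℝ) ^ 3 := le_self_pow₀ hH' (by norm_num)
  rw [le_div_iff₀ hΔ]
  calc H * gapBound H β * minGap M β ≤ (H : ℝ) ^ 3 * gapBound H β * gapBound H β := by gcongr
    _ = gapBound H β ^ 2 * (H : ℝ) ^ 3 * 1 * 1 := by ring
    _ ≤ _ := by gcongr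

theorem regret_le_mul [Nonempty A] {K : ℕ} {alg : Learner S A H} (hβ : β ≠ 0)
    (D : Fin K → Episode S A H) : regret M β alg D ≤ H * K := by
  refine (Finset.sum_le_card_nsmul _ _ (H : ℝ) fun k _ => ?_).trans_eq ?_
  · have h1 := VStar_le M hβ 0 M.s₁
    have h2 := V_nonneg M hβ (alg k fun i : Fin k => D (Fin.castLE k.isLt.le i)) 0 M.s₁
    simp only [Fin.val_zero, Nat.cast_zero, sub_zero] at h1
    linarith
  · simp [mul_comm]

variable [DecidableEq S] [DecidableEq A] {δ c : ℝ} {K : ℕ} {alg : Learner S A H}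

/-- The charge of a visit used for RSVI2. -/
def rsviCost (M : MDP S A H) (β δ c : ℝ) (K : ℕ) : ℕ → ℝ :=
  visitCost (c ^ 2 * ((Fintype.card S : ℝ) *
    Real.log (2 * Fintype.card S * Fintype.card A * H * K / δ))) (gapBound H β)
    (minGap M β / (2 * H))

theorem sumEarlier_episodeCost_nonneg
    (hL : 0 ≤ Real.log (2 * Fintype.card S * Fintype.card A * H * K / δ))
    (hβ : β ≠ 0) (hΔ : 0 < minGap M β) (hH : 1 ≤ H) (D : Fin K → Episode S A H) :
    0 ≤ sumEarlier (episodeCost M alg (rsviCost M β δ c K)) D := by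
  have hH' : (0 : ℝ) < H := by exact_mod_cast hH
  refine Finset.sum_nonneg fun k _ => costToGo_nonneg M _ (fun h s => ?_) _ _
  exact visitCost_nonneg (by positivity) (hH'.le.trans (le_gapBound H hβ)) (by positivity) _

variable [Nonempty A]

theorem regret_le_of_failureBound_lt_one (hβ : β ≠ 0) (hc : 0 ≤ c)
    (halg : IsRSVI2 M β δ c K alg)
    (hL : 0 ≤ Real.log (2 * Fintype.card S * Fintype.card A * H * K / δ))
    (hΔ : 0 < minGap M β) (hH : 1 ≤ H) (D : Fin K → Episode S A H)
    (hD : sumEarlier (failureBound M δ c K) D < 1) :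
    regret M β alg D ≤ 2 * sumEarlier (episodeCost M alg (rsviCost M β δ c K)) D := by
  rw [regret, sumEarlier, Finset.mul_sum]
  refine Finset.sum_le_sum fun k _ => ?_
  have hk : failureBound M δ c K k (earlier k.isLt.le D) < 1 :=
    (Finset.single_le_sum (f := fun k : Fin K => failureBound M δ c K k (earlier k.isLt.le D))
      (fun _ _ => failureBound_nonneg) (Finset.mem_univ k)).trans_lt hD
  exact VStar_sub_V_le M hβ hc (isConcentrated_of_failureBound_lt_one hc k.isLt hL hk)
    (halg k k.isLt _) hL hΔ hH

/-- Off the concentration event the failure sum is at least 1 and pays for the trivial regret bound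
HK. -/
theorem regret_le_add_failureBound (hβ : β ≠ 0) (hc : 0 ≤ c)
    (halg : IsRSVI2 M β δ c K alg)
    (hL : 0 ≤ Real.log (2 * Fintype.card S * Fintype.card A * H * K / δ))
    (hΔ : 0 < minGap M β) (hH : 1 ≤ H) (D : Fin K → Episode S A H) :
    regret M β alg D ≤ 2 * sumEarlier (episodeCost M alg (rsviCost M β δ c K)) D +
      H * K * sumEarlier (failureBound M δ c K) D := by
  have h0 := sumEarlier_episodeCost_nonneg (c := c) (alg := alg) M hL hβ hΔ hH D
  have hF0 : 0 ≤ sumEarlier (failureBound M δ c K) D :=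
    Finset.sum_nonneg fun _ _ => failureBound_nonneg
  have hHK : (0 : ℝ) ≤ H * K := by positivity
  by_cases hF : sumEarlier (failureBound M δ c K) D < 1
  · have := regret_le_of_failureBound_lt_one M hβ hc halg hL hΔ hH D hF
    have := mul_nonneg hHK hF0
    linarith
  · have := regret_le_mul (alg := alg) M hβ D
    have := mul_le_mul_of_nonneg_left (not_lt.1 hF) hHK
    linarith

/-- There are HSA triples, each with total charge at most B + bB²/ε (1 + log K). As 1/ε = 2H/Δ_min,
the main term carries only H²; H³ is a relaxation. The first term is absorbed using Δ_min ≤ B. -/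
theorem visitPotential_rsviCost_le (hβ : β ≠ 0) (hΔ : 0 < minGap M β) (hH : 1 ≤ H)
    {l : ℝ} (hl : 1 / 2 ≤ l)
    (hL0 : 0 ≤ Real.log (2 * Fintype.card S * Fintype.card A * H * K / δ))
    (hL : Real.log (2 * Fintype.card S * Fintype.card A * H * K / δ) ≤ 3 * l)
    (hK : 1 + Real.log K ≤ 3 * l) (D : Fin K → Episode S A H) :
    visitPotential (rsviCost M β δ c K) D ≤ (4 + 18 * c ^ 2) *
      (gapBound H β ^ 2 * (H : ℝ) ^ 3 * (Fintype.card S : ℝ) ^ 2 * (Fintype.card A : ℝ) /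
        minGap M β) * l ^ 2 := by
  have hH' : (1 : ℝ) ≤ H := by exact_mod_cast hH
  have hS : (1 : ℝ) ≤ Fintype.card S := by
    exact_mod_cast Fintype.card_pos_iff.2 ⟨M.s₁⟩
  have hlK : 0 ≤ Real.log K := Real.log_natCast_nonneg K
  have hB : 0 < gapBound H β := by linarith [le_gapBound H hβ]
  have hΔB := minGap_le_gapBound M hβ hΔ
  set L := Real.log (2 * Fintype.card S * Fintype.card A * H * K / δ)
  set s : ℝ := (Fintype.card S : ℝ)
  set a : ℝ := (Fintype.card A : ℝ)
  have ha : 0 ≤ a := Nat.cast_nonneg _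
  set B := gapBound H β
  set g := minGap M β
  refine (visitPotential_le D fun n hn => sum_visitCost_le (b := c ^ 2 * (s * L)) (B := B)
    (ε := g / (2 * H)) (by positivity) hB.le (by positivity) hn).trans ?_
  have hs2 : s ≤ s ^ 2 := by nlinarith
  have hh2 : (H : ℝ) ^ 2 ≤ (H : ℝ) ^ 3 := pow_le_pow_right₀ hH' (by norm_num)
  have hh1 : (H : ℝ) ≤ (H : ℝ) ^ 3 := le_self_pow₀ hH' (by norm_num)
  have hl2 : 1 ≤ 4 * l ^ 2 := by nlinarith
  have hBg : B ≤ B ^ 2 / g := by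
    rw [le_div_iff₀ hΔ]
    nlinarith
  have hLK : L * (1 + Real.log K) ≤ 3 * l * (3 * l) :=
    mul_le_mul hL hK (by linarith) (by linarith)
  have t1 : H * s * a * B ≤ (H : ℝ) ^ 3 * s ^ 2 * a * (B ^ 2 / g) * (4 * l ^ 2) := by
    have : H * s * a * B ≤ (H : ℝ) ^ 3 * s ^ 2 * a * (B ^ 2 / g) := by gcongr
    exact this.trans (le_mul_of_one_le_right (by positivity) hl2)
  have t2 : H * s * a * (c ^ 2 * (s * L) * B ^ 2 / (g / (2 * H)) * (1 + Real.log K)) ≤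
      (H : ℝ) ^ 3 * s ^ 2 * a * (B ^ 2 / g) * (18 * c ^ 2 * l ^ 2) := by
    calc H * s * a * (c ^ 2 * (s * L) * B ^ 2 / (g / (2 * H)) * (1 + Real.log K))
        = (H : ℝ) ^ 2 * s ^ 2 * a * (B ^ 2 / g) * (2 * c ^ 2) * (L * (1 + Real.log K)) := by
          field_simp
      _ ≤ (H : ℝ) ^ 3 * s ^ 2 * a * (B ^ 2 / g) * (2 * c ^ 2) * (3 * l * (3 * l)) := by gcongr
      _ = _ := by ring
  calc _ = H * s * a * B +
        H * s * a * (c ^ 2 * (s * L) * B ^ 2 / (g / (2 * H)) * (1 + Real.log K)) := by ring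
    _ ≤ _ := add_le_add t1 t2
    _ = _ := by ring

theorem one_sub_le_prob_regret_le (hβ : β ≠ 0) (hc : 3 ≤ c) (hK : 1 ≤ K) (hδ0 : 0 < δ) (hδ1 : δ ≤ 1)
    (halg : IsRSVI2 M β δ c K alg) (hΔ : 0 < minGap M β) (hH : 1 ≤ H) :
    1 - δ ≤ prob (runLaw M alg K) {D | regret M β alg D ≤ (24 + 72 * c ^ 2) *
      (gapBound H β ^ 2 * (H : ℝ) ^ 3 * (Fintype.card S : ℝ) ^ 2 * (Fintype.card A : ℝ) /
        minGap M β) * Real.log (H * Fintype.card S * Fintype.card A * K / δ) ^ 2} := by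
  have hA := two_le_card_action M hβ hΔ
  have hS : 1 ≤ Fintype.card S := Fintype.card_pos_iff.2 ⟨M.s₁⟩
  have hH' : (1 : ℝ) ≤ H := by exact_mod_cast hH
  have hK' : (1 : ℝ) ≤ K := by exact_mod_cast hK
  have hS' : (1 : ℝ) ≤ Fintype.card S := by exact_mod_cast hS
  have hA' : (2 : ℝ) ≤ Fintype.card A := by exact_mod_cast hA
  have hB : 0 < gapBound H β := by linarith [le_gapBound H hβ]
  have hHS : (1 : ℝ) ≤ H * Fintype.card S := one_le_mul_of_one_le_of_one_le hH' hS'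
  have hHSA : (2 : ℝ) ≤ H * Fintype.card S * Fintype.card A := by nlinarith
  have hX2 : (2 : ℝ) ≤ H * Fintype.card S * Fintype.card A * K := by nlinarith
  have hXK : (K : ℝ) ≤ H * Fintype.card S * Fintype.card A * K := by nlinarith
  set X : ℝ := H * Fintype.card S * Fintype.card A * K with hX
  have hXδ : X ≤ X / δ := by
    rw [le_div_iff₀ hδ0]
    nlinarith
  have hXδ0 : 0 < X / δ := by linarith
  have hlog2 : 1 / 2 ≤ Real.log 2 := by linarith [Real.log_two_gt_d9]
  set l := Real.log (X / δ) with hl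
  have hl2 : Real.log 2 ≤ l := Real.log_le_log two_pos (by linarith)
  have hLeq : Real.log (2 * Fintype.card S * Fintype.card A * H * K / δ) = Real.log 2 + l := by
    rw [hl, ← Real.log_mul two_ne_zero hXδ0.ne', hX]
    congr 1
    ring
  have hL0 : 0 ≤ Real.log (2 * Fintype.card S * Fintype.card A * H * K / δ) := by
    rw [hLeq]
    linarith
  have hlK : Real.log K ≤ l := Real.log_le_log (by linarith) (by linarith)
  have hlδ : Real.log (2 / δ) ≤ l :=
    Real.log_le_log (by positivity) (div_le_div_of_nonneg_right hX2 hδ0.le)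
  have hΦ := visitPotential_rsviCost_le (c := c) (δ := δ) (K := K) M hβ hΔ hH (l := l)
    (by linarith) hL0 (by linarith) (by linarith)
  have hHB := mul_gapBound_le M hβ hΔ hH
  set G := gapBound H β ^ 2 * (H : ℝ) ^ 3 * (Fintype.card S : ℝ) ^ 2 * (Fintype.card A : ℝ) /
    minGap M β
  have hHB0 : 0 < H * gapBound H β := by positivity
  set cost := sumEarlier (K := K) (episodeCost M alg (rsviCost M β δ c K)) with hcost
  have hfail := expect_sumEarlier_failureBound_le (δ := δ) (c := c) M alg hS (by linarith) hH hK
    hδ0 hδ1 hc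
  have hmart := expect_exp_sumEarlier_sub_visitPotential_le_one M alg
    (f := rsviCost M β δ c K) hB
    (visitCost_nonneg (by positivity) hB.le (by positivity))
    visitCost_le hH K
  have hfail2 : δ / (2 * Fintype.card S * Fintype.card A * H * K) ≤ δ / 2 := by
    refine div_le_div_of_nonneg_left hδ0.le two_pos ?_
    linarith
  -- Markov's inequality and the union bound in one pointwise estimate: on a record with large
  -- regret, one of the two subtracted terms is at least 1.
  have hpt (D : Fin K → Episode S A H) :
      1 - sumEarlier (failureBound M δ c K) D - δ / 2 * Real.exp ((cost D / 2 -
        visitPotential (rsviCost M β δ c K) D) / (H * gapBound H β)) ≤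
      Set.indicator {D | regret M β alg D ≤ (24 + 72 * c ^ 2) * G * l ^ 2} (fun _ => 1) D := by
    have hF0 : 0 ≤ sumEarlier (failureBound M δ c K) D :=
      Finset.sum_nonneg fun _ _ => failureBound_nonneg
    have hexp : 0 ≤ δ / 2 * Real.exp ((cost D / 2 -
        visitPotential (rsviCost M β δ c K) D) / (H * gapBound H β)) := by positivity
    by_cases hD : D ∈ {D | regret M β alg D ≤ (24 + 72 * c ^ 2) * G * l ^ 2}
    · rw [Set.indicator_of_mem hD]
      linarith
    · rw [Set.indicator_of_notMem hD]
      by_cases hF : sumEarlier (failureBound M δ c K) D < 1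
      · have h1 := regret_le_of_failureBound_lt_one M hβ (by linarith) halg hL0 hΔ hH D hF
        have h2 : (24 + 72 * c ^ 2) * G * l ^ 2 < regret M β alg D := not_le.1 hD
        -- The regret is at most twice the cost, which is compared with twice the potential plus 2HB
        -- log(2/δ). Hence the constant 4(4 + 18c²) + 4·2 = 24 + 72c².
        have h3 : H * gapBound H β * Real.log (2 / δ) ≤ 2 * (G * l ^ 2) := by
          have h4 : H * gapBound H β * Real.log (2 / δ) ≤ G * l :=
            mul_le_mul hHB hlδ (Real.log_nonneg ((one_le_div hδ0).2 (by linarith))) (by linarith)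
          have h5 : G * l ≤ G * (2 * l ^ 2) :=
            mul_le_mul_of_nonneg_left (by nlinarith) (by linarith)
          linarith
        have h6 : Real.log (2 / δ) ≤ (cost D / 2 -
            visitPotential (rsviCost M β δ c K) D) / (H * gapBound H β) := by
          rw [le_div_iff₀ hHB0]
          have := hΦ D
          linarith
        have h7 := Real.exp_le_exp.2 h6
        rw [Real.exp_log (by positivity)] at h7
        have h8 := mul_le_mul_of_nonneg_left h7 (half_pos hδ0).le
        have h9 : δ / 2 * (2 / δ) = 1 := by field_simp
        linarith
      · linarith
  refine le_trans ?_ (expect_mono _ hpt)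
  rw [expect_sub, expect_sub, expect_const, expect_const_mul]
  have := mul_le_mul_of_nonneg_left hmart (half_pos hδ0).le
  change _ ≤ 1 - expect (runLaw M alg K) (sumEarlier (failureBound M δ c K)) - _
  linarith

theorem expect_regret_le (hβ : β ≠ 0) (hc : 3 ≤ c) (hK : 1 ≤ K) (hδ0 : 0 < δ) (hδ1 : δ ≤ 1)
    (halg : IsRSVI2 M β δ c K alg) (hΔ : 0 < minGap M β) (hH : 1 ≤ H)
    (hδ : 1 / ((H : ℝ) * K) ≤ δ) :
    expect (runLaw M alg K) (fun D => regret M β alg D) ≤ (24 + 72 * c ^ 2) *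
      (gapBound H β ^ 2 * (H : ℝ) ^ 3 * (Fintype.card S : ℝ) ^ 2 * (Fintype.card A : ℝ) /
        minGap M β) * Real.log (H * Fintype.card S * Fintype.card A * K) ^ 2 := by
  have hA := two_le_card_action M hβ hΔ
  have hS : 1 ≤ Fintype.card S := Fintype.card_pos_iff.2 ⟨M.s₁⟩
  have hH' : (1 : ℝ) ≤ H := by exact_mod_cast hH
  have hK' : (1 : ℝ) ≤ K := by exact_mod_cast hK
  have hS' : (1 : ℝ) ≤ Fintype.card S := by exact_mod_cast hS
  have hA' : (2 : ℝ) ≤ Fintype.card A := by exact_mod_cast hA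
  have hSA : (1 : ℝ) ≤ Fintype.card S * Fintype.card A := by nlinarith
  have hHS : (1 : ℝ) ≤ H * Fintype.card S := one_le_mul_of_one_le_of_one_le hH' hS'
  have hHSA : (2 : ℝ) ≤ H * Fintype.card S * Fintype.card A := by nlinarith
  have hHK1 : (1 : ℝ) ≤ H * K := one_le_mul_of_one_le_of_one_le hH' hK'
  have hX2 : (2 : ℝ) ≤ H * Fintype.card S * Fintype.card A * K := by nlinarith
  have hXK : (K : ℝ) ≤ H * Fintype.card S * Fintype.card A * K := by nlinarith
  have hXHK : (H : ℝ) * K ≤ H * Fintype.card S * Fintype.card A * K := by nlinarith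
  set X : ℝ := H * Fintype.card S * Fintype.card A * K with hX
  have hlog2 : 1 / 2 ≤ Real.log 2 := by linarith [Real.log_two_gt_d9]
  set l := Real.log X with hl
  have hl2 : Real.log 2 ≤ l := Real.log_le_log two_pos hX2
  have hinv : 1 / δ ≤ X := by
    refine le_trans ?_ hXHK
    rw [div_le_iff₀ (by linarith)] at hδ
    rw [div_le_iff₀ hδ0]
    linarith
  have hinv1 : 1 ≤ 1 / δ := (one_le_div hδ0).2 hδ1
  have hLarg : 2 * Fintype.card S * Fintype.card A * H * K / δ = 2 * X * (1 / δ) := by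
    rw [hX]
    ring
  have hL0 : 0 ≤ Real.log (2 * Fintype.card S * Fintype.card A * H * K / δ) := by
    rw [hLarg]
    exact Real.log_nonneg (by nlinarith)
  have hL3 : Real.log (2 * Fintype.card S * Fintype.card A * H * K / δ) ≤ 3 * l := by
    rw [hLarg, Real.log_mul (by positivity) (by positivity), Real.log_mul two_ne_zero (by positivity)]
    have := Real.log_le_log (by positivity) hinv
    linarith
  have hlK : Real.log K ≤ l := Real.log_le_log (by linarith) hXK
  have hΦ := visitPotential_rsviCost_le (c := c) (δ := δ) (K := K) M hβ hΔ hH (l := l)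
    (by linarith) hL0 hL3 (by linarith)
  have hHB := mul_gapBound_le M hβ hΔ hH
  set G := gapBound H β ^ 2 * (H : ℝ) ^ 3 * (Fintype.card S : ℝ) ^ 2 * (Fintype.card A : ℝ) /
    minGap M β
  have hG : 1 ≤ G := by nlinarith [le_gapBound H hβ]
  have hfail := expect_sumEarlier_failureBound_le (δ := δ) (c := c) M alg hS (by linarith) hH hK
    hδ0 hδ1 hc
  -- The failure probability carries a factor 1/(HK) beyond δ, so failures add at most 1 to the
  -- expected regret for every δ ≤ 1.
  have hfail2 : H * K * expect (runLaw M alg K) (sumEarlier (failureBound M δ c K)) ≤ 1 := by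
    refine (mul_le_mul_of_nonneg_left hfail (by linarith)).trans ?_
    rw [← mul_div_assoc, div_le_one (by positivity)]
    calc H * K * δ ≤ H * K * (2 * (Fintype.card S * Fintype.card A)) :=
          mul_le_mul_of_nonneg_left (by linarith) (by linarith)
      _ = _ := by ring
  refine (expect_mono _ fun D =>
    regret_le_add_failureBound M hβ (by linarith) halg hL0 hΔ hH D).trans ?_
  rw [expect_add, expect_const_mul, expect_const_mul]
  change 2 * expect (runLaw M alg K) (sumEarlier (episodeCost M alg (rsviCost M β δ c K))) +
    H * K * expect (runLaw M alg K) (sumEarlier (failureBound M δ c K)) ≤ _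
  rw [expect_sumEarlier_episodeCost]
  have hΦ' := expect_le_of_le (runLaw M alg K) hΦ
  have hGl : 1 ≤ 4 * (G * l ^ 2) := by
    have : 1 ≤ 4 * l ^ 2 := by nlinarith
    nlinarith
  have hcl : 0 ≤ c ^ 2 * (G * l ^ 2) := by positivity
  change 2 * expect (runLaw M alg K) (fun D => visitPotential (rsviCost M β δ c K) D) + _ ≤ _
  linarith

end Regret

end RiskSensitiveRL
end
open RiskSensitiveRL
theorem theorem1 :
    ∃ c₀ : ℝ, 0 < c₀ ∧ ∀ c : ℝ, c₀ ≤ c → ∃ C : ℝ, 0 < C ∧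
      ∀ (S A : Type*) [Fintype S] [Fintype A] [DecidableEq S] [DecidableEq A]
        (H K : ℕ) (M : MDP S A H) (β δ : ℝ) (alg : Learner S A H),
        1 ≤ K → β ≠ 0 → 0 < δ → δ ≤ 1 → 0 < minGap M β → IsRSVI2 M β δ c K alg →
        (1 - δ ≤ prob (runLaw M alg K) {D | regret M β alg D ≤
            C * ((Real.exp (|β| * H) - 1) ^ 2 * (H : ℝ) ^ 3 * (Fintype.card S : ℝ) ^ 2 *
                (Fintype.card A : ℝ) / (|β| ^ 2 * minGap M β)) *
              Real.log (H * Fintype.card S * Fintype.card A * K / δ) ^ 2}) ∧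
        (1 / ((H : ℝ) * K) ≤ δ →
          expect (runLaw M alg K) (fun D => regret M β alg D) ≤
            C * ((Real.exp (|β| * H) - 1) ^ 2 * (H : ℝ) ^ 3 * (Fintype.card S : ℝ) ^ 2 *
                (Fintype.card A : ℝ) / (|β| ^ 2 * minGap M β)) *
              Real.log (H * Fintype.card S * Fintype.card A * K) ^ 2) := by
  refine ⟨3, by norm_num, fun c hc => ⟨24 + 72 * c ^ 2, by positivity, ?_⟩⟩
  intro S A _ _ _ _ H K M β δ alg hK hβ hδ0 hδ1 hΔ halg
  -- A positive minimal gap provides a step and an action, so the degenerate cases of no steps or no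
  -- actions do not arise.
  obtain ⟨h, -, a, -⟩ := exists_gap_ne_zero M hΔ
  have : Nonempty A := ⟨a⟩
  have hH : 1 ≤ H := (Nat.zero_le _).trans_lt h.isLt
  have hform : (Real.exp (|β| * H) - 1) ^ 2 * (H : ℝ) ^ 3 * (Fintype.card S : ℝ) ^ 2 *
      (Fintype.card A : ℝ) / (|β| ^ 2 * minGap M β) =
      gapBound H β ^ 2 * (H : ℝ) ^ 3 * (Fintype.card S : ℝ) ^ 2 * (Fintype.card A : ℝ) /
        minGap M β := by
    rw [gapBound_sq]
    field_simp
  rw [hform]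
  exact ⟨one_sub_le_prob_regret_le M hβ hc hK hδ0 hδ1 halg hΔ hH,
    expect_regret_le M hβ hc hK hδ0 hδ1 halg hΔ hH⟩
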